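/- **Setting.** Let $n,T\ge 1$, $\eta\in[0,1)$ and $p(1),\dots,p(T)\in(0,1]$. The ground truth is $g^*=(g^*(1),\dots,g^*(T))$ with $g^*(k)\in\mathbb C^n$, $|g^*_i(k)|=1$ and $g_1^*(k)=1$ for all $i,k$, and $\sum_{k=1}^{T-1}\|g^*(k)-g^*(k+1)\|_2^2\le S_T$ for some $S_T\ge 0$. In the *Outliers model* one observes random Hermitian $n\times n$ matrices $A(1),\dots,A(T)$ with zero diagonal whose entries $A_{ij}(k)$ ($i<j$, $k\le T$) are jointly independent, $A_{ij}(k)$ being equal to $g_i^*(k)\overline{g_j^*(k)}$ with probability $(1-\eta)p(k)$, uniform on the unit circle with probability $\eta p(k)$, and $0$ with probability $1-p(k)$. Let $v_1,\dots,v_T$ be orthonormal eigenvectors of the Laplacian of the path graph on $T$ vertices, with eigenvalues $\lambda_1\ge\dots\ge\lambda_T=0$, let $\mathcal P_{\tau}=\big(\sum_{k=0}^{\tau-1}v_{T-k}v_{T-k}^\top\big)\otimes I_n$ and $\mathcal P_\tau^\perp=I_{nT}-\mathcal P_\tau$. Let $\overline G^*\in\mathbb C^{nT\times n}$ be the stacked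 matrix with blocks $g^*(k)g^*(k)^{H}-I_n$, let $D=(1-\eta)\,\mathrm{blkdiag}(p(1)I_n,\dots,p(T)I_n)$ and $\bar d=\frac1T\sum_k(1-\eta)p(k)$. Assume that $D$ is $\mu$-smooth for some $\mu\ge1$: $\|\mathcal P^\perp_{\tau}(D\overline G^*)\|_F^2\le\mu\bar d^2\|\mathcal P_\tau^\perp\overline G^*\|_F^2$ for all $\tau\in\{1,\dots,T\}$. Put $p_{\max}=\max_kp(k)$, $p_{\min}=\min_kp(k)$, $V=\max_kp(k)(1-p(k))$, $f=p_{\max}\eta+(1-\eta)^2V+p_{\max}V(1-\eta)$, $Q=\eta+Q(\eta)+\max_kQ(p(k))$, where $Q(q)$ is the subgaussian norm $\|X\|_{\psi_2}=\sup_{r\ge1}r^{-1/2}(\mathbb E|X|^r)^{1/r}$ of a centered Bernoulli($q$) variable $X$. For $\delta\in(0,1)$ let $\tilde f=f+Q^2\log(1/\delta)$, $\rho=\dfrac{\mu\bar d^2T^2S_T}{n\tilde f}$ and $\tau^*=\min\{1+\lfloor\rho^{1/3}\rfloor,T\}$ (with $\tau^*=T$ if $\tilde f=0$). **Estimator.**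 With $A$ the stacked observations, let $\hat G=\mathcal P_{\tau^*}A$ with blocks $\hat G(k)$, let $\hat g'(k)$ be an eigenvector for the largest eigenvalue of $\frac12(\hat G(k)+\hat G(k)^H)$, and let $\hat g_i(k)=\mathrm{ph}(\hat g'_i(k))\,e^{-\iota\hat\theta_1(k)}$, where $\mathrm{ph}(z)=z/|z|$ for $z\ne0$, $\mathrm{ph}(0)=1$, and $\hat\theta_1(k)$ is the argument of $\hat g_1'(k)$ (and $0$ if $\hat g'_1(k)=0$). Let $\hat g=(\hat g(1),\dots,\hat g(T))$. **Corollary.** There are absolute constants $C_1\in(0,1)$ and $C_2,C_3,C_4>0$ such that for every $\delta\in(0,C_1)$ the following holds, whatever the choice of the eigenvectors. 1. With probability at least $1-\delta$, $$\|\hat g-g^*\|_2^2\le\frac{C_2}{(1-\eta)^2p_{\min}^2}\Big(\max\Big\{\frac{\mu\bar d^2nT^2S_T}{1+\rho^{2/3}},\ \mu\bar d^2nS_T\Big\}\mathbf 1_{\tau^*<T}+\tilde f\,n^2\min\{1+\rho^{1/3},T\}\Big)$$ (if $\tilde f=0$, the right-hand side is read as $0$). 2. If moreover $S_T>0$ and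 $T\ge C_3\max\Big\{\Big(\dfrac{n\tilde f}{\mu\bar d^2S_T}\Big)^{1/2},\dfrac{\mu\bar d^2S_T}{n\tilde f}\Big\}$, then the right-hand side in 1 is at most $$C_4\,\frac{\tilde f^{2/3}}{(1-\eta)^2p_{\min}^2}\,(\mu\bar d^2)^{1/3}n^{5/3}T^{2/3}S_T^{1/3},$$ so that on the same event $\|\hat g-g^*\|_2^2$ is bounded by this quantity. 3. (Sparse, possibly disconnected graphs.) For all $\eta\in(0,1)$, $a,b>0$ and $m\ge1$ there are $K_1,K_2>0$, depending only on $\eta,a,b,m$, such that if $a/n\le p(k)\le b/n$ for all $k$, $\mu\le m$, $S_T>0$, $\delta\in(0,C_1)$ and $T\ge K_1\max\Big\{\Big(\dfrac{n^3\log(1/\delta)}{S_T}\Big)^{1/2},\dfrac{S_T}{n^3\log(1/\delta)}\Big\}$, then with probability at least $1-\delta$, $\|\hat g-g^*\|_2^2\le K_2\,n^3T^{2/3}S_T^{1/3}\log^{2/3}(1/\delta)$. -/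

import Mathlib

open MeasureTheory ProbabilityTheory
open scoped Matrix Kronecker

universe u

namespace DynSync

/-! ### The path graph and the low-frequency projection -/

/-- Incidence matrix of the directed path on `T` vertices: column `e` is the edge `e → e + 1`. -/
def incidence (T : ℕ) : Matrix (Fin T) (Fin (T - 1)) ℝ :=
  fun i e => if i.val = e.val then 1 else if i.val = e.val + 1 then -1 else 0

/-- Laplacian `M Mᵀ` of the path graph on `T` vertices. -/
def pathLaplacian (T : ℕ) : Matrix (Fin T) (Fin T) ℝ :=
  incidence T * (incidence T)ᵀ

/-- `v 0, …, v (T - 1)` is an orthonormal family of eigenvectors of the path Laplacian, listed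
in the order of decreasing eigenvalues. -/
structure IsPathEigenbasis {T : ℕ} (v : Fin T → Fin T → ℝ) : Prop where
  orthonormal : ∀ i j, v i ⬝ᵥ v j = if i = j then 1 else 0
  eigen : ∃ lam : Fin T → ℝ, Antitone lam ∧ ∀ j, pathLaplacian T *ᵥ v j = lam j • v j

/-- The `T × T` matrix `∑ v_j v_jᵀ` over the last `τ` indices `j`, that is, over the `τ`
smallest eigenvalues. -/
noncomputable def lowFreq {T : ℕ} (v : Fin T → Fin T → ℝ) (τ : ℕ) : Matrix (Fin T) (Fin T) ℝ :=
  ∑ j : Fin T with T ≤ j.val + τ, Matrix.vecMulVec (v j) (v j)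

/-- `𝒫_{τ,n} = (∑ v_j v_jᵀ) ⊗ I_n`. -/
noncomputable def proj {T : ℕ} (n : ℕ) (v : Fin T → Fin T → ℝ) (τ : ℕ) :
    Matrix (Fin T × Fin n) (Fin T × Fin n) ℂ :=
  ((lowFreq v τ).map (fun x : ℝ => (x : ℂ))) ⊗ₖ (1 : Matrix (Fin n) (Fin n) ℂ)

/-! ### Stacked matrices and norms -/

/-- `concat(X(1), …, X(T))`. -/
def stack {n T : ℕ} (X : Fin T → Matrix (Fin n) (Fin n) ℂ) :
    Matrix (Fin T × Fin n) (Fin n) ℂ :=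
  fun r j => X r.1 r.2 j

/-- The `k`-th `n × n` block of a stacked matrix. -/
def block {n T : ℕ} (X : Matrix (Fin T × Fin n) (Fin n) ℂ) (k : Fin T) :
    Matrix (Fin n) (Fin n) ℂ :=
  fun i j => X (k, i) j

/-- Squared Frobenius norm. -/
noncomputable def frobSq {ι κ : Type*} [Fintype ι] [Fintype κ] (X : Matrix ι κ ℂ) : ℝ :=
  ∑ i, ∑ j, ‖X i j‖ ^ 2

/-- Squared Euclidean distance of two stacked vectors in `ℂ^{nT}`. -/
noncomputable def distSq {n T : ℕ} (g h : Fin T → Fin n → ℂ) : ℝ :=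
  ∑ k, ∑ i, ‖g k i - h k i‖ ^ 2

/-! ### The ground truth -/

/-- The stacked matrix with blocks `g(k) g(k)ᴴ - I_n`. -/
noncomputable def gBar {n T : ℕ} (g : Fin T → Fin n → ℂ) :
    Matrix (Fin T × Fin n) (Fin n) ℂ :=
  stack fun k => Matrix.vecMulVec (g k) (star (g k)) - 1

/-- Quadratic variation `∑_{k=1}^{T-1} ‖g(k) - g(k+1)‖₂²`. -/
noncomputable def quadVar {n T : ℕ} (g : Fin T → Fin n → ℂ) : ℝ :=
  ∑ k : Fin (T - 1), ∑ i,
    ‖g ⟨k.val, by omega⟩ i - g ⟨k.val + 1, by omega⟩ i‖ ^ 2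

/-- Unit-modulus phases, anchored at the first item, with quadratic variation at most `S`. -/
structure IsGroundTruth {n T : ℕ} [NeZero n] (g : Fin T → Fin n → ℂ) (S : ℝ) : Prop where
  unit : ∀ k i, ‖g k i‖ = 1
  anchor : ∀ k, g k 0 = 1
  smooth : quadVar g ≤ S

/-! ### The Outliers model -/

/-- Uniform distribution on the unit circle: the law of `exp(ι φ)` for `φ` uniform on
`[0, 2π)`. -/
noncomputable def uniformCircle : Measure ℂ :=
  Measure.map (fun φ : ℝ => Complex.exp (φ * Complex.I))
    (ProbabilityTheory.cond volume (Set.Ico 0 (2 * Real.pi)))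

/-- Law of one off-diagonal observation: the true relative phase `z` with probability
`(1 - η) p`, a uniform phase with probability `η p`, and `0` with probability `1 - p`. -/
noncomputable def entryLaw (η p : ℝ) (z : ℂ) : Measure ℂ :=
  ENNReal.ofReal ((1 - η) * p) • Measure.dirac z
    + ENNReal.ofReal (η * p) • uniformCircle
    + ENNReal.ofReal (1 - p) • Measure.dirac 0

/-- The random matrices `A(1), …, A(T)` follow the Outliers model with ground truth `g`, outlier
level `η` and connection probabilities `p(1), …, p(T)`: they are Hermitian with zero diagonal,
and the entries above the diagonal, over all times, are independent with law `entryLaw`. -/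
structure IsOutliersModel {n T : ℕ} {Ω : Type*} [MeasurableSpace Ω] (P : Measure Ω)
    (η : ℝ) (p : Fin T → ℝ) (g : Fin T → Fin n → ℂ)
    (A : Ω → Fin T → Matrix (Fin n) (Fin n) ℂ) : Prop where
  measurable : ∀ k i j, Measurable fun ω => A ω k i j
  diag : ∀ ω k i, A ω k i i = 0
  hermitian : ∀ ω k, (A ω k).IsHermitian
  indep : iIndepFun
    (fun (e : {e : Fin T × Fin n × Fin n // e.2.1 < e.2.2}) (ω : Ω) =>
      A ω e.1.1 e.1.2.1 e.1.2.2) P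
  law : ∀ k i j, i < j →
    Measure.map (fun ω => A ω k i j) P = entryLaw η (p k) (g k i * star (g k j))

/-- `D = (1 - η) blkdiag(p(1) I_n, …, p(T) I_n)`. -/
noncomputable def dMat {T : ℕ} (n : ℕ) (η : ℝ) (p : Fin T → ℝ) :
    Matrix (Fin T × Fin n) (Fin T × Fin n) ℂ :=
  Matrix.diagonal fun r => (((1 - η) * p r.1 : ℝ) : ℂ)

/-- `d̄ = (1 / T) ∑ₖ (1 - η) p(k)`. -/
noncomputable def dBar {T : ℕ} (η : ℝ) (p : Fin T → ℝ) : ℝ :=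
  (∑ k, (1 - η) * p k) / T

/-- The matrix `D` is `μ`-smooth. -/
def IsDSmooth {n T : ℕ} (v : Fin T → Fin T → ℝ) (η : ℝ) (p : Fin T → ℝ)
    (g : Fin T → Fin n → ℂ) (μ : ℝ) : Prop :=
  ∀ τ : ℕ, 1 ≤ τ → τ ≤ T →
    frobSq ((1 - proj n v τ) * (dMat n η p * gBar g))
      ≤ μ * dBar η p ^ 2 * frobSq ((1 - proj n v τ) * gBar g)

/-! ### The noise parameters -/

/-- Subgaussian norm `sup_{q ≥ 1} q^{-1/2} (𝔼 |X|^q)^{1/q}`. -/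
noncomputable def psiTwoNorm {Ω : Type*} [MeasurableSpace Ω] (P : Measure Ω) (X : Ω → ℝ) : ℝ :=
  ⨆ q : Set.Ici (1 : ℝ), (q : ℝ) ^ (-(1 / 2) : ℝ) * (∫ ω, |X ω| ^ (q : ℝ) ∂P) ^ (1 / (q : ℝ))

/-- Bernoulli distribution with parameter `p`, as a measure on `ℝ`. -/
noncomputable def bernoulliLaw (p : ℝ) : Measure ℝ :=
  ENNReal.ofReal p • Measure.dirac 1 + ENNReal.ofReal (1 - p) • Measure.dirac 0

/-- `Q(p)`: subgaussian norm of a centered Bernoulli variable with parameter `p`. -/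
noncomputable def bernoulliNorm (p : ℝ) : ℝ :=
  psiTwoNorm (bernoulliLaw p) fun x => x - p

/-- `p_max`. -/
noncomputable def pMax {T : ℕ} (p : Fin T → ℝ) : ℝ := ⨆ k, p k

/-- `p_min`. -/
noncomputable def pMin {T : ℕ} (p : Fin T → ℝ) : ℝ := ⨅ k, p k

/-- `V = max_k p(k) (1 - p(k))`. -/
noncomputable def varMax {T : ℕ} (p : Fin T → ℝ) : ℝ := ⨆ k, p k * (1 - p k)

/-- `Q = η + Q(η) + max_k Q(p(k))`. -/
noncomputable def qNoise {T : ℕ} (η : ℝ) (p : Fin T → ℝ) : ℝ :=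
  η + bernoulliNorm η + ⨆ k, bernoulliNorm (p k)

/-- `f(η, p_max, V) = p_max η + (1 - η)² V + p_max V (1 - η)`. -/
noncomputable def fNoise {T : ℕ} (η : ℝ) (p : Fin T → ℝ) : ℝ :=
  pMax p * η + (1 - η) ^ 2 * varMax p + pMax p * varMax p * (1 - η)

/-- `f̃ = f + Q² log(1/δ)`. -/
noncomputable def fTilde {T : ℕ} (η : ℝ) (p : Fin T → ℝ) (δ : ℝ) : ℝ :=
  fNoise η p + qNoise η p ^ 2 * Real.log (1 / δ)

/-- `μ d̄² T² S / (n f̃)`. -/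
noncomputable def ratio {T : ℕ} (n : ℕ) (η : ℝ) (p : Fin T → ℝ) (μ S δ : ℝ) : ℝ :=
  μ * dBar η p ^ 2 * (T : ℝ) ^ 2 * S / (n * fTilde η p δ)

/-- `τ* = min {1 + ⌊(μ d̄² T² S / (n f̃))^{1/3}⌋, T}`; in the noiseless case `f̃ = 0` the
quotient is infinite and `τ* = T`. -/
noncomputable def tauStar {T : ℕ} (n : ℕ) (η : ℝ) (p : Fin T → ℝ) (μ S δ : ℝ) : ℕ :=
  if fTilde η p δ = 0 then T
  else min (1 + ⌊(ratio n η p μ S δ) ^ (1 / 3 : ℝ)⌋₊) T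

/-! ### The algorithm -/

/-- `w` is an eigenvector of the Hermitian matrix `B` for its largest eigenvalue. -/
def IsTopEigenvector {n : ℕ} (B : Matrix (Fin n) (Fin n) ℂ) (w : Fin n → ℂ) : Prop :=
  ∃ lam : ℝ, Module.End.HasEigenvector (Matrix.toLin' B) (lam : ℂ) w ∧
    ∀ ν : ℝ, Module.End.HasEigenvalue (Matrix.toLin' B) (ν : ℂ) → ν ≤ lam

/-- Entrywise projection of a complex number onto the unit circle, with `0 ↦ 1`. -/
noncomputable def phase (z : ℂ) : ℂ := if z = 0 then 1 else z / (‖z‖ : ℂ)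

/-- Matrix denoising stage: `Ĝ = 𝒫_{τ,n} A`. -/
noncomputable def gHat {n T : ℕ} (v : Fin T → Fin T → ℝ) (τ : ℕ)
    (A : Fin T → Matrix (Fin n) (Fin n) ℂ) : Matrix (Fin T × Fin n) (Fin n) ℂ :=
  proj n v τ * stack A

/-- Hermitianized block `Ĝ'(k) = (Ĝ(k) + Ĝ(k)ᴴ) / 2`. -/
noncomputable def gHatHerm {n T : ℕ} (v : Fin T → Fin T → ℝ) (τ : ℕ)
    (A : Fin T → Matrix (Fin n) (Fin n) ℂ) (k : Fin T) : Matrix (Fin n) (Fin n) ℂ :=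
  (1 / 2 : ℂ) • (block (gHat v τ A) k + (block (gHat v τ A) k)ᴴ)

/-- `gh` is an output of global matrix denoising followed by local spectral synchronization, on
input `A` and `τ`. The output is a relation, because the top eigenvector `w` of a block is not
unique. In Mathlib `Complex.arg 0 = 0`, which is the convention of the algorithm. -/
def IsOutput {n T : ℕ} [NeZero n] (v : Fin T → Fin T → ℝ) (τ : ℕ)
    (A : Fin T → Matrix (Fin n) (Fin n) ℂ) (gh : Fin T → Fin n → ℂ) : Prop :=
  ∀ k, ∃ w : Fin n → ℂ, IsTopEigenvector (gHatHerm v τ A k) w ∧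
    ∀ i, gh k i = phase (w i) * Complex.exp (-(Complex.I * (Complex.arg (w 0) : ℂ)))

/-! ### The error bounds -/

/-- The general error bound, with constant `C`. -/
noncomputable def generalBound {T : ℕ} (C : ℝ) (n : ℕ) (η : ℝ) (p : Fin T → ℝ) (μ S δ : ℝ) : ℝ :=
  C / ((1 - η) ^ 2 * pMin p ^ 2) *
    (max (μ * dBar η p ^ 2 * n * (T : ℝ) ^ 2 * S / (1 + (ratio n η p μ S δ) ^ (2 / 3 : ℝ)))
        (μ * dBar η p ^ 2 * n * S) * (if tauStar n η p μ S δ < T then 1 else 0)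
      + fTilde η p δ * (n : ℝ) ^ 2 * min (1 + (ratio n η p μ S δ) ^ (1 / 3 : ℝ)) T)

/-- The condition that `T` is large, with constant `C`. -/
def LargeT {T : ℕ} (C : ℝ) (n : ℕ) (η : ℝ) (p : Fin T → ℝ) (μ S δ : ℝ) : Prop :=
  C * max ((n * fTilde η p δ / (μ * dBar η p ^ 2 * S)) ^ (1 / 2 : ℝ))
      (μ * dBar η p ^ 2 * S / (n * fTilde η p δ)) ≤ T

/-- The simplified error bound for large `T`, with constant `C`. -/
noncomputable def simpleBound {T : ℕ} (C : ℝ) (n : ℕ) (η : ℝ) (p : Fin T → ℝ) (μ S δ : ℝ) : ℝ :=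
  C * (fTilde η p δ ^ (2 / 3 : ℝ) / ((1 - η) ^ 2 * pMin p ^ 2)) *
    (μ * dBar η p ^ 2) ^ (1 / 3 : ℝ) * (n : ℝ) ^ (5 / 3 : ℝ) *
    (T : ℝ) ^ (2 / 3 : ℝ) * S ^ (1 / 3 : ℝ)

/-- `good` holds on a measurable event of probability at least `r`. -/
def WithProbAtLeast {Ω : Type*} [MeasurableSpace Ω] (P : Measure Ω) (r : ℝ)
    (good : Ω → Prop) : Prop :=
  ∃ E : Set Ω, MeasurableSet E ∧ r ≤ P.real E ∧ ∀ ω ∈ E, good ω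

/-- The standing assumptions. A connection probability `0` and the level `η = 1`, for which the
error bounds are infinite, are excluded. -/
structure IsSetting {n T : ℕ} [NeZero n] {Ω : Type*} [MeasurableSpace Ω] (P : Measure Ω)
    (v : Fin T → Fin T → ℝ) (η : ℝ) (p : Fin T → ℝ) (g : Fin T → Fin n → ℂ) (S μ : ℝ)
    (A : Ω → Fin T → Matrix (Fin n) (Fin n) ℂ) : Prop where
  prob : IsProbabilityMeasure P
  basis : IsPathEigenbasis v
  eta_nonneg : 0 ≤ η
  eta_lt_one : η < 1
  p_pos : ∀ k, 0 < p k
  p_le_one : ∀ k, p k ≤ 1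
  S_nonneg : 0 ≤ S
  truth : IsGroundTruth g S
  model : IsOutliersModel P η p g A
  mu_ge_one : 1 ≤ μ
  d_smooth : IsDSmooth v η p g μ

end DynSync

/-!
The estimator sees `A` only through `𝒫 A`, where `𝒫` projects onto the `τ*` lowest frequencies of
the path. The error `𝒫 A - D G*` is the sum of the bias `-𝒫^⊥ D G*` and the noise `𝒫 (A - D G*)`.

* Bias. By smoothness of `D` it suffices to bound `𝒫^⊥ G*`. The Laplacian eigenvalues outside the
  range of `𝒫` are at least of order `τ² / T²`, while the energy of `G*` along the path is at most
  of order `n S`, so the squared bias is of order `μ d̄² n T² S / τ²`. The eigenvalue bound is a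
  dimension count: some combination of the eigenvectors up to the given one vanishes on a grid of
  mesh `L ≈ T / τ`, and a sequence vanishing on such a grid has energy at least `L⁻²` times its
  squared norm.
* Noise. The entries of `A - D G*` are independent and centered with subgaussian norm at most of
  order `Q`. Each of the `n² τ` frequency components of the noise is a unit-norm combination of
  them, hence subgaussian, and by convexity of `exp` the average of their squares has an
  exponential moment. The squared noise thus exceeds the order of `n² τ Q² log(1/δ)` with
  probability at most `δ`.

The cut-off `τ*` balances the two. Finally, each block of `D G*` is a multiple of `g gᴴ - I`, whose
top eigenvector is `g`, so that the squared distance of the anchored phases of the top eigenvector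
of `Ĝ(k)` to `g*(k)` is at most of the order of the squared Frobenius error of the block.
-/

namespace DynSync

/-! ### Entrywise projection onto the unit circle -/

theorem norm_phase (z : ℂ) : ‖phase z‖ = 1 := by
  unfold phase
  split_ifs with hz <;> simp [hz]

theorem norm_mul_phase (z : ℂ) : (‖z‖ : ℂ) * phase z = z := by
  unfold phase
  split_ifs with hz
  · simp [hz]
  · exact mul_div_cancel₀ z (by simpa using hz)

theorem phase_real_mul {c : ℝ} (hc : 0 < c) (z : ℂ) : phase (c * z) = phase z := by
  have hc' : (c : ℂ) ≠ 0 := by exact_mod_cast hc.ne'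
  simp only [phase, mul_eq_zero, hc', false_or, norm_mul, Complex.norm_real,
    Real.norm_of_nonneg hc.le, Complex.ofReal_mul, mul_div_mul_left z _ hc']

theorem norm_phase_sub_self (z : ℂ) : ‖phase z - z‖ = |1 - ‖z‖| := by
  have hz : phase z - z = ((1 - ‖z‖ : ℝ) : ℂ) * phase z := by
    push_cast
    rw [sub_mul, one_mul, norm_mul_phase]
  rw [hz, norm_mul, norm_phase, mul_one, Complex.norm_real, Real.norm_eq_abs]

theorem norm_phase_sub_le {u : ℂ} (hu : ‖u‖ = 1) (z : ℂ) : ‖phase z - u‖ ≤ 2 * ‖z - u‖ :=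
  calc ‖phase z - u‖ ≤ ‖phase z - z‖ + ‖z - u‖ := norm_sub_le_norm_sub_add_norm_sub _ _ _
    _ = |‖u‖ - ‖z‖| + ‖z - u‖ := by rw [norm_phase_sub_self, hu]
    _ ≤ ‖u - z‖ + ‖z - u‖ := by gcongr; exact abs_norm_sub_norm_le u z
    _ = 2 * ‖z - u‖ := by rw [norm_sub_rev u z]; ring

theorem phase_star {z : ℂ} (hz : z ≠ 0) :
    phase (star z) = Complex.exp (-(Complex.I * (Complex.arg z : ℂ))) := by
  have hz' : (‖z‖ : ℂ) ≠ 0 := by simpa using hz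
  rw [phase, if_neg (by simpa using hz), norm_star, div_eq_iff hz', mul_comm]
  conv_lhs => rw [← Complex.norm_mul_exp_arg_mul_I z]
  simp only [RCLike.star_def, map_mul, Complex.conj_ofReal, ← Complex.exp_conj, Complex.conj_I]
  ring_nf

theorem phase_mul {a b : ℂ} (ha : a ≠ 0) (hb : b ≠ 0) : phase (a * b) = phase a * phase b := by
  simp only [phase, mul_eq_zero, ha, hb, or_self, if_false, norm_mul, Complex.ofReal_mul,
    mul_div_mul_comm]

theorem norm_phase_mul_exp_arg_sub_le {u : ℂ} (hu : ‖u‖ = 1) (a b : ℂ) :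
    ‖phase a * Complex.exp (-(Complex.I * (Complex.arg b : ℂ))) - u‖ ≤ 2 * ‖a * star b - u‖ := by
  rcases eq_or_ne (a * star b) 0 with hab | hab
  · refine (norm_sub_le _ _).trans_eq ?_
    rw [hab, zero_sub, norm_neg, norm_mul, norm_phase, hu, Complex.norm_exp]
    norm_num
  · have hb : b ≠ 0 := by simpa using right_ne_zero_of_mul hab
    rw [← phase_star hb, ← phase_mul (left_ne_zero_of_mul hab) (right_ne_zero_of_mul hab)]
    exact norm_phase_sub_le hu _

/-! ### The squared Frobenius norm -/

section Frobenius

variable {ι κ : Type*} [Fintype ι] [Fintype κ]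

theorem frobSq_nonneg (X : Matrix ι κ ℂ) : 0 ≤ frobSq X := by
  unfold frobSq; positivity

theorem frobSq_add_le (X Y : Matrix ι κ ℂ) : frobSq (X + Y) ≤ 2 * (frobSq X + frobSq Y) := by
  simp only [frobSq, ← Finset.sum_add_distrib, Finset.mul_sum]
  gcongr
  exact (pow_le_pow_left₀ (norm_nonneg _) (norm_add_le _ _) 2).trans add_sq_le

theorem frobSq_conjTranspose (X : Matrix ι κ ℂ) : frobSq Xᴴ = frobSq X := by
  simp only [frobSq, Matrix.conjTranspose_apply, norm_star]
  exact Finset.sum_comm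

theorem frobSq_smul (c : ℂ) (X : Matrix ι κ ℂ) : frobSq (c • X) = ‖c‖ ^ 2 * frobSq X := by
  simp [frobSq, Finset.mul_sum, mul_pow]

theorem frobSq_neg (X : Matrix ι κ ℂ) : frobSq (-X) = frobSq X := by
  simp [frobSq]

theorem frobSq_eq_re_trace (X : Matrix ι κ ℂ) : frobSq X = (Xᴴ * X).trace.re := by
  simp only [frobSq, Matrix.trace, Matrix.diag_apply, Matrix.mul_apply, Matrix.conjTranspose_apply,
    RCLike.star_def, Complex.conj_mul', ← Complex.ofReal_pow, ← Complex.ofReal_sum,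
    Complex.ofReal_re]
  exact Finset.sum_comm

theorem re_trace_conjTranspose_mul_comm (X Y : Matrix ι κ ℂ) :
    (Xᴴ * Y).trace.re = (Yᴴ * X).trace.re := by
  have h : (Xᴴ * Y).trace = star (Yᴴ * X).trace := by
    rw [← Matrix.trace_conjTranspose, Matrix.conjTranspose_mul, Matrix.conjTranspose_conjTranspose]
  rw [h, RCLike.star_def, Complex.conj_re]

theorem frobSq_sub (X Y : Matrix ι κ ℂ) :
    frobSq (X - Y) = frobSq X + frobSq Y - 2 * (Xᴴ * Y).trace.re := by
  simp only [frobSq_eq_re_trace, Matrix.conjTranspose_sub, Matrix.sub_mul, Matrix.mul_sub,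
    Matrix.trace_sub, Complex.sub_re, re_trace_conjTranspose_mul_comm Y X]
  ring

theorem re_trace_conjTranspose_mul_sq_le (X Y : Matrix ι κ ℂ) :
    (Xᴴ * Y).trace.re ^ 2 ≤ frobSq X * frobSq Y := by
  have hsum : (Xᴴ * Y).trace = ∑ q : ι × κ, star (X q.1 q.2) * Y q.1 q.2 := by
    rw [Fintype.sum_prod_type_right]
    rfl
  have habs : |(Xᴴ * Y).trace.re| ≤ ∑ q : ι × κ, ‖X q.1 q.2‖ * ‖Y q.1 q.2‖ := by
    refine (Complex.abs_re_le_norm _).trans (hsum ▸ (norm_sum_le _ _).trans_eq ?_)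
    simp only [norm_mul, norm_star]
  calc (Xᴴ * Y).trace.re ^ 2 = |(Xᴴ * Y).trace.re| ^ 2 := (sq_abs _).symm
    _ ≤ (∑ q : ι × κ, ‖X q.1 q.2‖ * ‖Y q.1 q.2‖) ^ 2 := by gcongr
    _ ≤ (∑ q : ι × κ, ‖X q.1 q.2‖ ^ 2) * ∑ q : ι × κ, ‖Y q.1 q.2‖ ^ 2 :=
        Finset.sum_mul_sq_le_sq_mul_sq _ _ _
    _ = frobSq X * frobSq Y := by simp only [frobSq, Fintype.sum_prod_type]

theorem frobSq_vecMulVec (x : ι → ℂ) (y : κ → ℂ) :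
    frobSq (Matrix.vecMulVec x y) = (∑ i, ‖x i‖ ^ 2) * ∑ j, ‖y j‖ ^ 2 := by
  simp only [frobSq, Matrix.vecMulVec_apply, norm_mul, mul_pow, Finset.sum_mul_sum]

theorem frobSq_realPart_le (X : Matrix ι ι ℂ) : frobSq (realPart X : Matrix ι ι ℂ) ≤ frobSq X := by
  have hX : (realPart X : Matrix ι ι ℂ) = (1 / 2 : ℂ) • (X + Xᴴ) := by
    rw [realPart_apply_coe, ← Complex.coe_smul, Matrix.star_eq_conjTranspose]
    norm_num
  have hadd := frobSq_add_le X Xᴴ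
  rw [frobSq_conjTranspose] at hadd
  rw [hX, frobSq_smul]
  norm_num
  linarith

theorem sum_frobSq_block {n T : ℕ} (X : Matrix (Fin T × Fin n) (Fin n) ℂ) :
    ∑ k, frobSq (block X k) = frobSq X :=
  (Fintype.sum_prod_type fun r => ∑ j, ‖X r j‖ ^ 2).symm

end Frobenius

/-! ### Perturbation of the top eigenvector -/

section TopEigenvector

variable {n : ℕ} {B : Matrix (Fin n) (Fin n) ℂ} {w g : Fin n → ℂ}

theorem star_dotProduct_self {ι : Type*} [Fintype ι] (x : ι → ℂ) :
    star x ⬝ᵥ x = ((∑ i, ‖x i‖ ^ 2 : ℝ) : ℂ) := by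
  simp [dotProduct, Complex.conj_mul']

open scoped ComplexOrder in
theorem re_star_dotProduct_mulVec_le (hB : B.IsHermitian) {lam : ℝ}
    (hmax : ∀ ν : ℝ, Module.End.HasEigenvalue (Matrix.toLin' B) (ν : ℂ) → ν ≤ lam)
    (x : Fin n → ℂ) : (star x ⬝ᵥ (B *ᵥ x)).re ≤ lam * ∑ i, ‖x i‖ ^ 2 := by
  have hdiff : ((lam : ℂ) • 1 - B).PosSemidef := by
    refine Matrix.posSemidef_iff_isHermitian_and_spectrum_nonneg.mpr ⟨?_, ?_⟩
    · exact (Matrix.isHermitian_one.smul (Complex.conj_ofReal lam)).sub hB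
    · rw [← Algebra.algebraMap_eq_smul_one, ← spectrum.singleton_sub_eq]
      rintro _ ⟨_, rfl, ν, hν, rfl⟩
      obtain ⟨r, -, rfl⟩ := hB.spectrum_eq_image_range ▸ hν
      rw [← Matrix.spectrum_toLin', ← Module.End.hasEigenvalue_iff_mem_spectrum] at hν
      simpa [← Complex.ofReal_sub] using hmax r hν
  have hx := hdiff.re_dotProduct_nonneg x
  simp only [Matrix.sub_mulVec, Matrix.smul_mulVec, Matrix.one_mulVec, dotProduct_sub,
    dotProduct_smul, star_dotProduct_self, smul_eq_mul, map_sub, RCLike.re_to_complex,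
    ← Complex.ofReal_mul, Complex.ofReal_re] at hx
  linarith

theorem IsTopEigenvector.smul (hw : IsTopEigenvector B w) {c : ℂ} (hc : c ≠ 0) :
    IsTopEigenvector B (c • w) := by
  obtain ⟨lam, ⟨hmem, hne⟩, hmax⟩ := hw
  exact ⟨lam, ⟨Submodule.smul_mem _ c hmem, smul_ne_zero hc hne⟩, hmax⟩

theorem IsTopEigenvector.sum_norm_sq_pos (hw : IsTopEigenvector B w) : 0 < ∑ i, ‖w i‖ ^ 2 := by
  obtain ⟨_, ⟨-, hne⟩, -⟩ := hw
  obtain ⟨i, hi⟩ := Function.ne_iff.mp hne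
  have : 0 < ‖w i‖ := norm_pos_iff.mpr hi
  exact Finset.sum_pos' (fun _ _ => by positivity) ⟨i, Finset.mem_univ i, by positivity⟩

theorem IsTopEigenvector.re_trace_mul_sub_nonneg (hB : B.IsHermitian)
    (hw : IsTopEigenvector B w) (hwg : ∑ i, ‖w i‖ ^ 2 = ∑ i, ‖g i‖ ^ 2) :
    0 ≤ (B * (Matrix.vecMulVec w (star w) - Matrix.vecMulVec g (star g))).trace.re := by
  obtain ⟨lam, ⟨hmem, -⟩, hmax⟩ := hw
  have hBw : B *ᵥ w = (lam : ℂ) • w := by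
    simpa [Module.End.mem_eigenspace_iff] using hmem
  rw [mul_sub, Matrix.mul_vecMulVec, Matrix.mul_vecMulVec, Matrix.trace_sub,
    Matrix.trace_vecMulVec, Matrix.trace_vecMulVec, dotProduct_comm, dotProduct_comm (B *ᵥ g), hBw,
    dotProduct_smul, star_dotProduct_self, smul_eq_mul, ← Complex.ofReal_mul, Complex.sub_re,
    Complex.ofReal_re, hwg, sub_nonneg]
  exact re_star_dotProduct_mulVec_le hB hmax g

theorem IsTopEigenvector.sq_mul_frobSq_vecMulVec_sub_le (hB : B.IsHermitian)
    (hw : IsTopEigenvector B w) (hwg : ∑ i, ‖w i‖ ^ 2 = ∑ i, ‖g i‖ ^ 2) {d : ℝ} (hd : 0 ≤ d) :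
    d ^ 2 * frobSq (Matrix.vecMulVec w (star w) - Matrix.vecMulVec g (star g))
      ≤ 4 * frobSq (B - (d : ℂ) • (Matrix.vecMulVec g (star g) - 1)) := by
  set G := Matrix.vecMulVec g (star g) with hG
  set X := Matrix.vecMulVec w (star w) - G with hX
  set E := B - (d : ℂ) • (G - 1) with hE
  have hXH : Xᴴ = X := by
    simp only [hX, hG, Matrix.conjTranspose_sub, Matrix.conjTranspose_vecMulVec, star_star]
  have htrace : X.trace = 0 := by
    rw [hX, hG, Matrix.trace_sub, Matrix.trace_vecMulVec, Matrix.trace_vecMulVec, dotProduct_comm,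
      dotProduct_comm g, star_dotProduct_self, star_dotProduct_self, hwg, sub_self]
  -- `w wᴴ` and `g gᴴ` have the same norm, so `⟪X, g gᴴ⟫ = -‖X‖² / 2`.
  have hXG : 2 * (Xᴴ * G).trace.re = -frobSq X := by
    have hpolar := frobSq_sub (Matrix.vecMulVec w (star w)) G
    have hnorm : frobSq (Matrix.vecMulVec w (star w)) = frobSq G := by
      simp only [hG, frobSq_vecMulVec, Pi.star_apply, norm_star, hwg]
    rw [hX, Matrix.conjTranspose_sub, sub_mul, Matrix.trace_sub, Complex.sub_re,
      ← frobSq_eq_re_trace, ← hX]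
    linarith
  have hXB : 0 ≤ (Xᴴ * B).trace.re := by
    rw [hXH, Matrix.trace_mul_comm]
    exact hw.re_trace_mul_sub_nonneg hB hwg
  have hXE : d * frobSq X ≤ 2 * (Xᴴ * E).trace.re := by
    have hsplit : (Xᴴ * E).trace = (Xᴴ * B).trace - d * (Xᴴ * G).trace := by
      simp only [hE, mul_sub, mul_smul_comm, mul_one, Matrix.trace_sub, Matrix.trace_smul,
        smul_eq_mul, hXH, htrace]
      ring
    rw [hsplit, Complex.sub_re, Complex.re_ofReal_mul]
    linear_combination d * hXG + 2 * hXB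
  have hXX := frobSq_nonneg X
  have hcs : frobSq X * (d ^ 2 * frobSq X) ≤ frobSq X * (4 * frobSq E) := by
    calc frobSq X * (d ^ 2 * frobSq X) = (d * frobSq X) ^ 2 := by ring
      _ ≤ (2 * (Xᴴ * E).trace.re) ^ 2 := by gcongr
      _ = 4 * (Xᴴ * E).trace.re ^ 2 := by ring
      _ ≤ 4 * (frobSq X * frobSq E) := by gcongr; exact re_trace_conjTranspose_mul_sq_le X E
      _ = _ := by ring
  rcases hXX.eq_or_lt with h0 | hpos
  · simpa [← h0] using frobSq_nonneg E
  · exact le_of_mul_le_mul_left hcs hpos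

variable [NeZero n]

theorem IsTopEigenvector.sq_mul_sum_norm_phase_sub_le (hB : B.IsHermitian)
    (hw : IsTopEigenvector B w) (hg : ∀ i, ‖g i‖ = 1) (hg0 : g 0 = 1) {d : ℝ} (hd : 0 ≤ d) :
    d ^ 2 * ∑ i, ‖phase (w i) * Complex.exp (-(Complex.I * (Complex.arg (w 0) : ℂ))) - g i‖ ^ 2
      ≤ 16 * frobSq (B - (d : ℂ) • (Matrix.vecMulVec g (star g) - 1)) := by
  -- The estimate depends only on the ray of `w`, so `w` may be given the norm of `g`.
  have hw0 := hw.sum_norm_sq_pos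
  have hn : (0 : ℝ) < n := by exact_mod_cast NeZero.pos n
  set c : ℝ := √(n / ∑ i, ‖w i‖ ^ 2)
  have hc : 0 < c := by positivity
  set x : Fin n → ℂ := (c : ℂ) • w with hx
  have hxtop : IsTopEigenvector B x := hw.smul (by exact_mod_cast hc.ne')
  have hxg : ∑ i, ‖x i‖ ^ 2 = ∑ i, ‖g i‖ ^ 2 := by
    have hc2 : c ^ 2 * ∑ i, ‖w i‖ ^ 2 = n := by
      rw [Real.sq_sqrt (by positivity), div_mul_cancel₀ _ hw0.ne']
    simpa [hx, hg, mul_pow, ← Finset.mul_sum] using hc2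
  have hterm (i : Fin n) :
      ‖phase (w i) * Complex.exp (-(Complex.I * (Complex.arg (w 0) : ℂ))) - g i‖
        ≤ 2 * ‖x i * star (x 0) - g i * star (g 0)‖ := by
    have := norm_phase_mul_exp_arg_sub_le (hg i) (x i) (x 0)
    simpa only [hx, Pi.smul_apply, smul_eq_mul, phase_real_mul hc, Complex.arg_real_mul _ hc, hg0,
      star_one, mul_one] using this
  have hcol : ∑ i, ‖x i * star (x 0) - g i * star (g 0)‖ ^ 2
      ≤ frobSq (Matrix.vecMulVec x (star x) - Matrix.vecMulVec g (star g)) :=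
    Finset.sum_le_sum fun i _ => Finset.single_le_sum
      (f := fun j => ‖x i * star (x j) - g i * star (g j)‖ ^ 2) (fun _ _ => sq_nonneg _)
      (Finset.mem_univ 0)
  calc _ ≤ d ^ 2 * ∑ i, (2 * ‖x i * star (x 0) - g i * star (g 0)‖) ^ 2 := by
        gcongr with i; exact hterm i
    _ = 4 * (d ^ 2 * ∑ i, ‖x i * star (x 0) - g i * star (g 0)‖ ^ 2) := by
        simp only [mul_pow, ← Finset.mul_sum]; ring
    _ ≤ 4 * (d ^ 2 * frobSq (Matrix.vecMulVec x (star x) - Matrix.vecMulVec g (star g))) := by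
        gcongr
    _ ≤ 4 * (4 * frobSq (B - (d : ℂ) • (Matrix.vecMulVec g (star g) - 1))) := by
        refine mul_le_mul_of_nonneg_left ?_ (by norm_num)
        exact hxtop.sq_mul_frobSq_vecMulVec_sub_le hB hxg hd
    _ = _ := by ring

theorem sq_mul_distSq_le_frobSq {T : ℕ} {v : Fin T → Fin T → ℝ} {τ : ℕ}
    {A : Fin T → Matrix (Fin n) (Fin n) ℂ} {g gh : Fin T → Fin n → ℂ} (hg : ∀ k i, ‖g k i‖ = 1)
    (hg0 : ∀ k, g k 0 = 1) (hgh : IsOutput v τ A gh) {η : ℝ} {p : Fin T → ℝ} {d : ℝ} (hd : 0 ≤ d)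
    (hdp : ∀ k, d ≤ (1 - η) * p k) :
    d ^ 2 * distSq gh g ≤ 16 * frobSq (gHat v τ A - dMat n η p * gBar g) := by
  rw [distSq, ← sum_frobSq_block, Finset.mul_sum, Finset.mul_sum]
  refine Finset.sum_le_sum fun k _ => ?_
  obtain ⟨w, hw, hwk⟩ := hgh k
  set dk : ℝ := (1 - η) * p k with hdk
  set R : Matrix (Fin n) (Fin n) ℂ := Matrix.vecMulVec (g k) (star (g k)) - 1 with hR
  have hherm : gHatHerm v τ A k = realPart (block (gHat v τ A) k) := by
    rw [gHatHerm, realPart_apply_coe, ← Complex.coe_smul, Matrix.star_eq_conjTranspose]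
    norm_num
  have hRsa : IsSelfAdjoint ((dk : ℂ) • R) := by
    rw [IsSelfAdjoint, Matrix.star_eq_conjTranspose]
    simp [hR, Matrix.conjTranspose_vecMulVec]
  have hblock : block (gHat v τ A - dMat n η p * gBar g) k
      = block (gHat v τ A) k - (dk : ℂ) • R := by
    ext i j
    simp only [block, dMat, gBar, stack, Matrix.sub_apply, Matrix.diagonal_mul, Matrix.smul_apply,
      smul_eq_mul, hR, hdk]
  have herr : gHatHerm v τ A k - (dk : ℂ) • R
      = realPart (block (gHat v τ A - dMat n η p * gBar g) k) := by
    rw [hherm, hblock, map_sub, AddSubgroupClass.coe_sub, hRsa.coe_realPart]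
  have hB : (gHatHerm v τ A k).IsHermitian := hherm ▸ (realPart _).2
  simp only [hwk]
  calc _ ≤ dk ^ 2 * ∑ i, ‖phase (w i) * Complex.exp (-(Complex.I * (Complex.arg (w 0) : ℂ)))
          - g k i‖ ^ 2 := by gcongr; exact hdp k
    _ ≤ 16 * frobSq (gHatHerm v τ A k - (dk : ℂ) • R) :=
        hw.sq_mul_sum_norm_phase_sub_le hB (hg k) (hg0 k) (hd.trans (hdp k))
    _ ≤ _ := by rw [herr]; gcongr; exact frobSq_realPart_le _

end TopEigenvector

/-! ### Orthonormal expansions -/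

section Orthonormal

variable {ι κ : Type*} [Fintype ι] [DecidableEq κ]

theorem sum_sq_sum_vecMulVec_mulVec {v : κ → ι → ℝ}
    (hv : ∀ i j, v i ⬝ᵥ v j = if i = j then 1 else 0) (s : Finset κ) (x : ι → ℝ) :
    ∑ k, ((∑ l ∈ s, Matrix.vecMulVec (v l) (v l)) *ᵥ x) k ^ 2 = ∑ l ∈ s, (v l ⬝ᵥ x) ^ 2 := by
  have hexp : (∑ l ∈ s, Matrix.vecMulVec (v l) (v l)) *ᵥ x = ∑ l ∈ s, (v l ⬝ᵥ x) • v l := by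
    rw [Matrix.sum_mulVec]
    exact Finset.sum_congr rfl fun l _ => by simp [Matrix.vecMulVec_mulVec]
  have hdot (y : ι → ℝ) : ∑ k, y k ^ 2 = y ⬝ᵥ y := by simp only [dotProduct, sq]
  simp only [hdot, hexp, dotProduct_sum, sum_dotProduct, dotProduct_smul, smul_dotProduct, hv,
    smul_eq_mul, mul_ite, mul_one, mul_zero]
  refine Finset.sum_congr rfl fun l hl => ?_
  rw [Finset.sum_ite_eq' s l, if_pos hl, sq]

variable [DecidableEq ι] {v : ι → ι → ℝ} (hv : ∀ i j, v i ⬝ᵥ v j = if i = j then 1 else 0)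
include hv

theorem sum_vecMulVec_self_eq_one : ∑ l, Matrix.vecMulVec (v l) (v l) = 1 := by
  have hright : Matrix.of v * (Matrix.of v)ᵀ = 1 := by
    ext i j
    rw [Matrix.one_apply, ← hv i j]
    rfl
  rw [← mul_eq_one_comm.mp hright]
  ext i j
  simp [Matrix.sum_apply, Matrix.mul_apply, Matrix.vecMulVec_apply]

theorem sum_sq_eq_sum_dotProduct_sq (x : ι → ℝ) : ∑ k, x k ^ 2 = ∑ l, (v l ⬝ᵥ x) ^ 2 := by
  rw [← sum_sq_sum_vecMulVec_mulVec hv, sum_vecMulVec_self_eq_one hv, Matrix.one_mulVec]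

theorem dotProduct_mulVec_eq_sum_mul_dotProduct_sq {M : Matrix ι ι ℝ} {lam : ι → ℝ}
    (hM : ∀ j, M *ᵥ v j = lam j • v j) (x : ι → ℝ) :
    x ⬝ᵥ (M *ᵥ x) = ∑ l, lam l * (v l ⬝ᵥ x) ^ 2 := by
  have hx : M *ᵥ x = ∑ l, (lam l * (v l ⬝ᵥ x)) • v l := by
    conv_lhs => rw [← Matrix.one_mulVec x, ← sum_vecMulVec_self_eq_one hv, Matrix.sum_mulVec,
      Matrix.mulVec_sum]
    refine Finset.sum_congr rfl fun l _ => ?_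
    simp [Matrix.vecMulVec_mulVec, Matrix.mulVec_smul, hM, smul_smul, mul_comm]
  rw [hx, dotProduct_sum]
  refine Finset.sum_congr rfl fun l _ => ?_
  rw [dotProduct_smul, dotProduct_comm, smul_eq_mul]
  ring

end Orthonormal

/-! ### Spectral gap of the path -/

section Path

variable {T : ℕ}

/-- The Dirichlet form of the path graph, that is, the quadratic form of `pathLaplacian T`. -/
noncomputable def pathEnergy (x : Fin T → ℝ) : ℝ :=
  ∑ e : Fin (T - 1), (x ⟨e.val, by omega⟩ - x ⟨e.val + 1, by omega⟩) ^ 2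

theorem pathEnergy_nonneg (x : Fin T → ℝ) : 0 ≤ pathEnergy x :=
  Finset.sum_nonneg fun _ _ => sq_nonneg _

theorem transpose_incidence_mulVec (x : Fin T → ℝ) (e : Fin (T - 1)) :
    ((incidence T)ᵀ *ᵥ x) e = x ⟨e.val, by omega⟩ - x ⟨e.val + 1, by omega⟩ := by
  have hterm (i : Fin T) : incidence T i e * x i =
      (if i = ⟨e.val, by omega⟩ then x i else 0)
        - (if i = ⟨e.val + 1, by omega⟩ then x i else 0) := by
    simp only [incidence, Fin.ext_iff]
    split_ifs <;> first | omega | simp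
  simp only [Matrix.mulVec, dotProduct, Matrix.transpose_apply, hterm, Finset.sum_sub_distrib,
    Finset.sum_ite_eq', Finset.mem_univ, if_true]

theorem dotProduct_pathLaplacian_mulVec (x : Fin T → ℝ) :
    x ⬝ᵥ (pathLaplacian T *ᵥ x) = pathEnergy x := by
  rw [pathLaplacian, ← Matrix.mulVec_mulVec, Matrix.dotProduct_mulVec, ← Matrix.mulVec_transpose]
  simp only [dotProduct, transpose_incidence_mulVec, pathEnergy, sq]

theorem pathEnergy_re_add_pathEnergy_im (z : Fin T → ℂ) :
    pathEnergy (fun k => (z k).re) + pathEnergy (fun k => (z k).im)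
      = ∑ e : Fin (T - 1), ‖z ⟨e.val, by omega⟩ - z ⟨e.val + 1, by omega⟩‖ ^ 2 := by
  simp only [pathEnergy, ← Finset.sum_add_distrib, Complex.sq_norm, Complex.normSq_apply,
    Complex.sub_re, Complex.sub_im, ← sq]

theorem sq_le_mul_sum_sq_sub_of_eq_zero {y : ℕ → ℝ} {a i L : ℕ} (hai : a ≤ i) (hiL : i ≤ a + L)
    (ha : y a = 0) : y i ^ 2 ≤ L * ∑ e ∈ Finset.Ico a i, (y e - y (e + 1)) ^ 2 := by
  have htel : ∑ e ∈ Finset.Ico a i, (y e - y (e + 1)) = -y i := by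
    rw [← neg_inj, ← Finset.sum_neg_distrib]
    simp only [neg_sub, neg_neg, Finset.sum_Ico_sub y hai, ha, sub_zero]
  have hcard : ((Finset.Ico a i).card : ℝ) ≤ L := by
    rw [Nat.card_Ico]
    exact_mod_cast (by omega : i - a ≤ L)
  calc y i ^ 2 = (∑ e ∈ Finset.Ico a i, (y e - y (e + 1))) ^ 2 := by rw [htel, neg_sq]
    _ ≤ (Finset.Ico a i).card * ∑ e ∈ Finset.Ico a i, (y e - y (e + 1)) ^ 2 :=
        sq_sum_le_card_mul_sum_sq
    _ ≤ _ := by gcongr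

theorem sum_range_sq_le_of_eq_zero_of_dvd {y : ℕ → ℝ} {L : ℕ} (hL : 0 < L)
    (hy : ∀ i < T, L ∣ i → y i = 0) :
    ∑ i ∈ Finset.range T, y i ^ 2
      ≤ (L : ℝ) ^ 2 * ∑ e ∈ Finset.range (T - 1), (y e - y (e + 1)) ^ 2 := by
  -- The sum telescopes from the last multiple of `L`, so an edge `e` serves only the vertices
  -- of `(e, e + L]`.
  have hpoint : ∀ i ∈ Finset.range T, y i ^ 2 ≤ L * ∑ e ∈ Finset.range (T - 1),
      if i ∈ Finset.Ioc e (e + L) then (y e - y (e + 1)) ^ 2 else 0 := by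
    intro i hi
    rw [Finset.mem_range] at hi
    have hai : L * (i / L) ≤ i := Nat.mul_div_le i L
    have hia : i < L * (i / L) + L := Nat.lt_mul_div_succ i hL
    refine (sq_le_mul_sum_sq_sub_of_eq_zero hai hia.le
      (hy _ (hai.trans_lt hi) (dvd_mul_right _ _))).trans ?_
    rw [← Finset.sum_filter]
    gcongr
    intro e he
    simp only [Finset.mem_Ico, Finset.mem_filter, Finset.mem_range, Finset.mem_Ioc] at he ⊢
    omega
  have hcount (e : ℕ) (r : ℝ) (hr : 0 ≤ r) :
      ∑ i ∈ Finset.range T, (if i ∈ Finset.Ioc e (e + L) then r else 0) ≤ L * r := by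
    rw [← Finset.sum_filter, Finset.sum_const, nsmul_eq_mul]
    gcongr
    calc ((Finset.range T).filter (· ∈ Finset.Ioc e (e + L))).card
        ≤ (Finset.Ioc e (e + L)).card :=
          Finset.card_le_card fun i hi => (Finset.mem_filter.mp hi).2
      _ = L := by simp
  calc ∑ i ∈ Finset.range T, y i ^ 2
      ≤ ∑ i ∈ Finset.range T, L * ∑ e ∈ Finset.range (T - 1),
          if i ∈ Finset.Ioc e (e + L) then (y e - y (e + 1)) ^ 2 else 0 :=
        Finset.sum_le_sum hpoint
    _ = L * ∑ e ∈ Finset.range (T - 1), ∑ i ∈ Finset.range T,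
          if i ∈ Finset.Ioc e (e + L) then (y e - y (e + 1)) ^ 2 else 0 := by
        rw [← Finset.mul_sum, Finset.sum_comm]
    _ ≤ L * ∑ e ∈ Finset.range (T - 1), L * (y e - y (e + 1)) ^ 2 := by
        gcongr with e; exact hcount e _ (sq_nonneg _)
    _ = _ := by rw [← Finset.mul_sum]; ring

theorem sum_sq_le_sq_mul_pathEnergy {x : Fin T → ℝ} {L : ℕ} (hL : 0 < L)
    (hx : ∀ i : Fin T, L ∣ i.val → x i = 0) : ∑ i, x i ^ 2 ≤ (L : ℝ) ^ 2 * pathEnergy x := by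
  set y : ℕ → ℝ := fun i => if h : i < T then x ⟨i, h⟩ else 0
  have hyx {i : ℕ} (hi : i < T) : y i = x ⟨i, hi⟩ := dif_pos hi
  have hnorm : ∑ i, x i ^ 2 = ∑ i ∈ Finset.range T, y i ^ 2 := by
    rw [← Fin.sum_univ_eq_sum_range fun i => y i ^ 2]
    simp only [hyx (Fin.is_lt _)]
  have henergy : pathEnergy x = ∑ e ∈ Finset.range (T - 1), (y e - y (e + 1)) ^ 2 := by
    rw [← Fin.sum_univ_eq_sum_range fun e => (y e - y (e + 1)) ^ 2, pathEnergy]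
    exact Finset.sum_congr rfl fun e _ => by rw [hyx, hyx]
  rw [hnorm, henergy]
  exact sum_range_sq_le_of_eq_zero_of_dvd hL fun i hi hLi => (hyx hi).trans (hx ⟨i, hi⟩ hLi)

theorem exists_ne_zero_forall_dotProduct_eq_zero {K ι κ : Type*} [Field K] [Fintype ι] [Fintype κ]
    (hcard : Fintype.card κ < Fintype.card ι) (r : κ → ι → K) :
    ∃ x : ι → K, x ≠ 0 ∧ ∀ k, r k ⬝ᵥ x = 0 := by
  have hker : LinearMap.ker (Matrix.mulVecLin (Matrix.of r)) ≠ ⊥ :=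
    LinearMap.ker_ne_bot_of_finrank_lt (by simpa only [Module.finrank_fintype_fun_eq_card])
  obtain ⟨x, hx, hx0⟩ := Submodule.exists_mem_ne_zero_of_ne_bot hker
  exact ⟨x, hx0, congrFun (LinearMap.mem_ker.mp hx)⟩

theorem exists_mul_mem_Icc_two_mul {τ : ℕ} (hτ : 1 ≤ τ) (hτT : τ ≤ T) :
    ∃ L, T ≤ L * τ ∧ L * τ ≤ 2 * T := by
  refine ⟨T / τ + 1, ?_, ?_⟩
  · exact mul_comm τ _ ▸ (Nat.lt_mul_div_succ T hτ).le
  · have := Nat.div_mul_le_self T τ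
    rw [add_mul, one_mul]
    omega

variable {v : Fin T → Fin T → ℝ} {lam : Fin T → ℝ}

theorem IsPathEigenbasis.pathEnergy_eq_sum (hv : IsPathEigenbasis v)
    (hlam : ∀ j, pathLaplacian T *ᵥ v j = lam j • v j) (x : Fin T → ℝ) :
    pathEnergy x = ∑ l, lam l * (v l ⬝ᵥ x) ^ 2 := by
  rw [← dotProduct_pathLaplacian_mulVec, dotProduct_mulVec_eq_sum_mul_dotProduct_sq hv.1 hlam]

theorem IsPathEigenbasis.eigenvalue_nonneg (hv : IsPathEigenbasis v)
    (hlam : ∀ j, pathLaplacian T *ᵥ v j = lam j • v j) (l : Fin T) : 0 ≤ lam l := by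
  have henergy := dotProduct_pathLaplacian_mulVec (v l)
  rw [hlam, dotProduct_smul, hv.orthonormal, if_pos rfl, smul_eq_mul, mul_one] at henergy
  exact henergy ▸ pathEnergy_nonneg _

theorem IsPathEigenbasis.pathEnergy_le_mul_sum_sq (hv : IsPathEigenbasis v) (hanti : Antitone lam)
    (hlam : ∀ j, pathLaplacian T *ᵥ v j = lam j • v j) {j : Fin T} {x : Fin T → ℝ}
    (hx : ∀ l < j, v l ⬝ᵥ x = 0) : pathEnergy x ≤ lam j * ∑ i, x i ^ 2 := by
  rw [hv.pathEnergy_eq_sum hlam, sum_sq_eq_sum_dotProduct_sq hv.1, Finset.mul_sum]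
  refine Finset.sum_le_sum fun l _ => ?_
  rcases lt_or_ge l j with hl | hl
  · simp [hx l hl]
  · exact mul_le_mul_of_nonneg_right (hanti hl) (sq_nonneg _)

/-- Dimension count: being orthogonal to `j` vectors and vanishing at the at most `τ` multiples of
`L` below `T` are fewer than `T` linear conditions. -/
theorem exists_ne_zero_dotProduct_eq_zero_and_eq_zero_of_dvd (v : Fin T → Fin T → ℝ) {τ L : ℕ}
    {j : Fin T} (hj : j.val + τ < T) (hLτ : T ≤ L * τ) :
    ∃ x : Fin T → ℝ, x ≠ 0 ∧ (∀ l < j, v l ⬝ᵥ x = 0) ∧ ∀ i : Fin T, L ∣ i.val → x i = 0 := by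
  let r : Fin j ⊕ Fin τ → Fin T → ℝ := Sum.elim (fun l => v (Fin.castLE j.is_lt.le l))
    fun m => if h : L * m.val < T then Pi.single ⟨L * m.val, h⟩ 1 else 0
  obtain ⟨x, hx0, hx⟩ := exists_ne_zero_forall_dotProduct_eq_zero (by simpa using hj) r
  refine ⟨x, hx0, fun l hl => hx (Sum.inl ⟨l, hl⟩), ?_⟩
  rintro i ⟨m, hm⟩
  have hmT : L * m < T := hm ▸ i.is_lt
  have hmτ : m < τ := lt_of_mul_lt_mul_left (hmT.trans_le hLτ) L.zero_le
  have hxm := hx (Sum.inr ⟨m, hmτ⟩)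
  simp only [r, Sum.elim_inr, dif_pos hmT, single_dotProduct, one_mul] at hxm
  rwa [show i = ⟨L * m, hmT⟩ from Fin.ext hm]

theorem IsPathEigenbasis.sq_le_mul_eigenvalue (hv : IsPathEigenbasis v) (hanti : Antitone lam)
    (hlam : ∀ j, pathLaplacian T *ᵥ v j = lam j • v j) {τ : ℕ} (hτ : 1 ≤ τ) {j : Fin T}
    (hj : j.val + τ < T) : (τ : ℝ) ^ 2 ≤ 4 * (T : ℝ) ^ 2 * lam j := by
  obtain ⟨L, hLτ, hL2⟩ := exists_mul_mem_Icc_two_mul hτ (by omega : τ ≤ T)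
  have hL : 0 < L := Nat.pos_of_mul_pos_right (j.pos.trans_le hLτ)
  obtain ⟨x, hx0, hxv, hxL⟩ := exists_ne_zero_dotProduct_eq_zero_and_eq_zero_of_dvd v hj hLτ
  have hpos : 0 < ∑ i, x i ^ 2 := by
    obtain ⟨i, hi⟩ := Function.ne_iff.mp hx0
    exact Finset.sum_pos' (fun _ _ => sq_nonneg _) ⟨i, Finset.mem_univ i, sq_pos_of_ne_zero hi⟩
  have hpoincare : 1 ≤ (L : ℝ) ^ 2 * lam j := by
    refine le_of_mul_le_mul_right ?_ hpos
    calc 1 * ∑ i, x i ^ 2 ≤ (L : ℝ) ^ 2 * pathEnergy x := by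
          rw [one_mul]; exact sum_sq_le_sq_mul_pathEnergy hL hxL
      _ ≤ (L : ℝ) ^ 2 * (lam j * ∑ i, x i ^ 2) := by
          gcongr; exact hv.pathEnergy_le_mul_sum_sq hanti hlam hxv
      _ = _ := by ring
  have hlam0 := hv.eigenvalue_nonneg hlam j
  calc (τ : ℝ) ^ 2 = (τ : ℝ) ^ 2 * 1 := (mul_one _).symm
    _ ≤ (τ : ℝ) ^ 2 * ((L : ℝ) ^ 2 * lam j) := by gcongr
    _ = ((L * τ : ℕ) : ℝ) ^ 2 * lam j := by push_cast; ring
    _ ≤ ((2 * T : ℕ) : ℝ) ^ 2 * lam j := by gcongr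
    _ = _ := by push_cast; ring

/-! ### Low-frequency projections of stacked matrices -/

theorem IsPathEigenbasis.one_sub_lowFreq (hv : IsPathEigenbasis v) (τ : ℕ) :
    1 - lowFreq v τ = ∑ l : Fin T with ¬ T ≤ l.val + τ, Matrix.vecMulVec (v l) (v l) := by
  rw [lowFreq, sub_eq_iff_eq_add', ← sum_vecMulVec_self_eq_one hv.1,
    Finset.sum_filter_add_sum_filter_not]

theorem IsPathEigenbasis.sq_mul_sum_sq_one_sub_lowFreq_le (hv : IsPathEigenbasis v) {τ : ℕ}
    (hτ : 1 ≤ τ) (x : Fin T → ℝ) :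
    (τ : ℝ) ^ 2 * ∑ k, ((1 - lowFreq v τ) *ᵥ x) k ^ 2 ≤ 4 * (T : ℝ) ^ 2 * pathEnergy x := by
  obtain ⟨lam, hanti, hlam⟩ := hv.eigen
  rw [hv.one_sub_lowFreq, sum_sq_sum_vecMulVec_mulVec hv.1, hv.pathEnergy_eq_sum hlam,
    Finset.mul_sum, Finset.mul_sum]
  calc _ ≤ ∑ l : Fin T with ¬ T ≤ l.val + τ, 4 * (T : ℝ) ^ 2 * (lam l * (v l ⬝ᵥ x) ^ 2) := by
        refine Finset.sum_le_sum fun l hl => ?_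
        have hlτ : l.val + τ < T := not_le.mp (Finset.mem_filter.mp hl).2
        rw [← mul_assoc]
        gcongr
        exact hv.sq_le_mul_eigenvalue hanti hlam hτ hlτ
    _ ≤ _ := Finset.sum_le_sum_of_subset_of_nonneg (Finset.filter_subset _ _) fun l _ _ => by
        have := hv.eigenvalue_nonneg hlam l
        positivity

variable {n : ℕ}

theorem map_ofReal_kronecker_one_mul_apply {ι κ μ : Type*} [Fintype κ] [Fintype μ] [DecidableEq μ]
    {ν : Type*} (R : Matrix ι κ ℝ) (X : Matrix (κ × μ) ν ℂ) (k : ι) (i : μ) (j : ν) :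
    ((R.map (fun x : ℝ => (x : ℂ)) ⊗ₖ (1 : Matrix μ μ ℂ)) * X) (k, i) j
      = ∑ k', (R k k' : ℂ) * X (k', i) j := by
  simp [Matrix.mul_apply, Fintype.sum_prod_type, Matrix.one_apply]

theorem frobSq_map_ofReal_kronecker_one_mul {ι κ μ ν : Type*} [Fintype ι] [Fintype κ] [Fintype μ]
    [Fintype ν] [DecidableEq μ] (R : Matrix ι κ ℝ) (X : Matrix (κ × μ) ν ℂ) :
    frobSq ((R.map (fun x : ℝ => (x : ℂ)) ⊗ₖ (1 : Matrix μ μ ℂ)) * X)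
      = ∑ i, ∑ j, (∑ k, (R *ᵥ fun k' => (X (k', i) j).re) k ^ 2
          + ∑ k, (R *ᵥ fun k' => (X (k', i) j).im) k ^ 2) := by
  have hentry (k : ι) (i : μ) (j : ν) :
      ‖((R.map (fun x : ℝ => (x : ℂ)) ⊗ₖ (1 : Matrix μ μ ℂ)) * X) (k, i) j‖ ^ 2
        = (R *ᵥ fun k' => (X (k', i) j).re) k ^ 2 + (R *ᵥ fun k' => (X (k', i) j).im) k ^ 2 := by
    simp only [map_ofReal_kronecker_one_mul_apply, Complex.sq_norm, Complex.normSq_apply,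
      Complex.re_sum, Complex.im_sum, Complex.re_ofReal_mul, Complex.im_ofReal_mul, Matrix.mulVec,
      dotProduct, ← sq]
  simp only [frobSq, Fintype.sum_prod_type, hentry, ← Finset.sum_add_distrib]
  rw [Finset.sum_comm]
  exact Finset.sum_congr rfl fun i _ => Finset.sum_comm

theorem one_sub_proj (v : Fin T → Fin T → ℝ) (τ : ℕ) :
    1 - proj n v τ = (1 - lowFreq v τ).map (fun x : ℝ => (x : ℂ)) ⊗ₖ
      (1 : Matrix (Fin n) (Fin n) ℂ) := by
  ext ⟨k, i⟩ ⟨k', i'⟩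
  by_cases hk : k = k' <;> by_cases hi : i = i' <;>
    simp [proj, Matrix.kroneckerMap_apply, hk, hi]

theorem IsPathEigenbasis.frobSq_proj_mul (hv : IsPathEigenbasis v) (τ : ℕ)
    (X : Matrix (Fin T × Fin n) (Fin n) ℂ) :
    frobSq (proj n v τ * X) = ∑ i, ∑ j, ∑ l : Fin T with T ≤ l.val + τ,
      ((v l ⬝ᵥ fun k => (X (k, i) j).re) ^ 2 + (v l ⬝ᵥ fun k => (X (k, i) j).im) ^ 2) := by
  simp only [proj, frobSq_map_ofReal_kronecker_one_mul, lowFreq,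
    sum_sq_sum_vecMulVec_mulVec hv.1, Finset.sum_add_distrib]

theorem IsPathEigenbasis.one_sub_proj_self (hv : IsPathEigenbasis v) : 1 - proj n v T = 0 := by
  rw [one_sub_proj, hv.one_sub_lowFreq, Finset.sum_eq_zero (by simp),
    Matrix.map_zero _ Complex.ofReal_zero, Matrix.zero_kronecker]

theorem IsPathEigenbasis.sq_mul_frobSq_one_sub_proj_mul_le (hv : IsPathEigenbasis v) {τ : ℕ}
    (hτ : 1 ≤ τ) (X : Matrix (Fin T × Fin n) (Fin n) ℂ) :
    (τ : ℝ) ^ 2 * frobSq ((1 - proj n v τ) * X) ≤ 4 * (T : ℝ) ^ 2 * ∑ e : Fin (T - 1),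
      frobSq (block X ⟨e.val, by omega⟩ - block X ⟨e.val + 1, by omega⟩) := by
  rw [one_sub_proj, frobSq_map_ofReal_kronecker_one_mul]
  calc _ ≤ 4 * (T : ℝ) ^ 2 * ∑ i, ∑ j, (pathEnergy (fun k => (X (k, i) j).re)
          + pathEnergy (fun k => (X (k, i) j).im)) := by
        simp only [Finset.mul_sum, mul_add]
        gcongr <;> exact (Finset.mul_sum _ _ _).symm.trans_le
          (hv.sq_mul_sum_sq_one_sub_lowFreq_le hτ _)
    _ = _ := by
        simp only [pathEnergy_re_add_pathEnergy_im, frobSq, block, Matrix.sub_apply]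
        rw [Finset.sum_comm (γ := Fin (T - 1))]
        simp only [Finset.sum_comm (γ := Fin (T - 1))]

theorem norm_mul_star_sub_mul_star_sq_le {a d : ℂ} (ha : ‖a‖ = 1) (hd : ‖d‖ = 1) (b c : ℂ) :
    ‖a * star c - b * star d‖ ^ 2 ≤ 2 * (‖a - b‖ ^ 2 + ‖c - d‖ ^ 2) := by
  have htri : ‖a * star c - b * star d‖ ≤ ‖a - b‖ + ‖c - d‖ :=
    calc ‖a * star c - b * star d‖ = ‖(a - b) * star d + a * star (c - d)‖ := by
          rw [star_sub]; ring_nf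
      _ ≤ ‖(a - b) * star d‖ + ‖a * star (c - d)‖ := norm_add_le _ _
      _ = ‖a - b‖ + ‖c - d‖ := by simp [ha, hd, ← map_sub]
  exact (pow_le_pow_left₀ (norm_nonneg _) htri 2).trans add_sq_le

theorem sum_frobSq_block_gBar_sub_le {g : Fin T → Fin n → ℂ} (hg : ∀ k i, ‖g k i‖ = 1) :
    ∑ e : Fin (T - 1),
        frobSq (block (gBar g) ⟨e.val, by omega⟩ - block (gBar g) ⟨e.val + 1, by omega⟩)
      ≤ 4 * n * quadVar g := by
  rw [quadVar, Finset.mul_sum]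
  refine Finset.sum_le_sum fun e _ => ?_
  set x := g ⟨e.val, by omega⟩
  set y := g ⟨e.val + 1, by omega⟩
  calc _ ≤ ∑ i, ∑ j, 2 * (‖x i - y i‖ ^ 2 + ‖x j - y j‖ ^ 2) := by
        refine Finset.sum_le_sum fun i _ => Finset.sum_le_sum fun j _ => ?_
        simpa [block, gBar, stack, Matrix.vecMulVec_apply] using
          norm_mul_star_sub_mul_star_sq_le (hg _ i) (hg _ j) (y i) (x j)
    _ = _ := by
        simp only [← Finset.mul_sum, Finset.sum_add_distrib, Finset.sum_const, Finset.card_univ,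
          Fintype.card_fin, nsmul_eq_mul]
        ring

theorem IsPathEigenbasis.sq_mul_frobSq_one_sub_proj_mul_gBar_le (hv : IsPathEigenbasis v) {τ : ℕ}
    (hτ : 1 ≤ τ) {g : Fin T → Fin n → ℂ} (hg : ∀ k i, ‖g k i‖ = 1) :
    (τ : ℝ) ^ 2 * frobSq ((1 - proj n v τ) * gBar g) ≤ 16 * (T : ℝ) ^ 2 * n * quadVar g :=
  calc _ ≤ 4 * (T : ℝ) ^ 2 * (4 * n * quadVar g) :=
        (hv.sq_mul_frobSq_one_sub_proj_mul_le hτ _).trans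
          (by gcongr; exact sum_frobSq_block_gBar_sub_le hg)
    _ = _ := by ring

end Path

/-! ### Subgaussian moments -/

section SubgaussianMoments

open scoped NNReal

variable {Ω : Type*} [MeasurableSpace Ω] {P : Measure Ω} {X : Ω → ℝ} {c : ℝ≥0}

/-- `X` has subgaussian moments with variance proxy `c`: its moment of order `2 m` is at most
`(2 c m)^m`. For centered variables this is equivalent to `HasSubgaussianMGF`, up to an absolute
factor in `c`; it is the form in which the subgaussian norm bounds a variable. -/
structure HasSubgaussianMoments (X : Ω → ℝ) (c : ℝ≥0) (P : Measure Ω) : Prop where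
  memLp : ∀ q : ℝ≥0, MemLp X q P
  integral_pow_le : ∀ m : ℕ, 1 ≤ m → ∫ ω, X ω ^ (2 * m) ∂P ≤ (c * (2 * m)) ^ m

theorem exp_le_add_exp_sq (x : ℝ) : Real.exp x ≤ x + Real.exp (x ^ 2) := by
  rcases le_or_gt |x| 1 with h | h
  · have h1 := (abs_le.mp (Real.abs_exp_sub_one_sub_id_le h)).2
    linarith [Real.add_one_le_exp (x ^ 2)]
  · rcases lt_abs.mp h with h1 | h1
    · have : Real.exp x ≤ Real.exp (x ^ 2) := Real.exp_le_exp.mpr (by nlinarith)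
      linarith
    · have : Real.exp x ≤ 1 := Real.exp_le_one_iff.mpr (by linarith)
      nlinarith [Real.add_one_le_exp (x ^ 2)]

theorem exp_natCast_le_three_pow (m : ℕ) : Real.exp m ≤ 3 ^ m := by
  rw [← Real.exp_one_pow]
  exact pow_le_pow_left₀ (Real.exp_pos _).le (by linarith [Real.exp_one_lt_d9]) m

theorem natCast_pow_le_three_pow_mul_factorial (m : ℕ) :
    (m : ℝ) ^ m ≤ 3 ^ m * (m.factorial : ℝ) := by
  have h := Real.pow_div_factorial_le_exp (x := (m : ℝ)) (by positivity) m
  rw [div_le_iff₀ (by positivity)] at h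
  exact h.trans (by gcongr; exact exp_natCast_le_three_pow m)

theorem pow_le_factorial_mul_exp_add_exp (m : ℕ) (y : ℝ) {t : ℝ} (ht : 0 < t) :
    y ^ (2 * m) ≤ ((2 * m).factorial : ℝ) / t ^ (2 * m)
      * (Real.exp (t * y) + Real.exp (-t * y)) := by
  have hseries : (t * y) ^ (2 * m) / ((2 * m).factorial : ℝ) ≤ Real.exp |t * y| := by
    simpa only [pow_mul, sq_abs] using
      Real.pow_div_factorial_le_exp (x := |t * y|) (abs_nonneg _) (2 * m)
  have habs : Real.exp |t * y| ≤ Real.exp (t * y) + Real.exp (-t * y) := by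
    rw [neg_mul]
    exact Real.exp_abs_le _
  calc y ^ (2 * m) = ((2 * m).factorial : ℝ) / t ^ (2 * m)
        * ((t * y) ^ (2 * m) / ((2 * m).factorial : ℝ)) := by
        rw [mul_pow]; field_simp
    _ ≤ _ := by gcongr; exact hseries.trans habs

theorem exp_mul_le_exp_mul_exp_sq {c : ℝ} (hc : 0 < c) (t x : ℝ) :
    Real.exp (t * x) ≤ Real.exp (3 * c * t ^ 2) * Real.exp (1 / (12 * c) * x ^ 2) := by
  rw [← Real.exp_add, Real.exp_le_exp]
  have hsq : 3 * c * t ^ 2 + 1 / (12 * c) * x ^ 2 - t * x = 3 * c * (t - x / (6 * c)) ^ 2 := by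
    field_simp
    ring
  have : 0 ≤ 3 * c * (t - x / (6 * c)) ^ 2 := by positivity
  linarith

namespace HasSubgaussianMoments

protected theorem zero (c : ℝ≥0) : HasSubgaussianMoments (fun _ => 0) c P where
  memLp _ := MemLp.zero'
  integral_pow_le m hm := by
    rw [zero_pow (by omega), integral_zero]
    positivity

theorem integrable_pow [IsFiniteMeasure P] (h : HasSubgaussianMoments X c P) (m : ℕ) :
    Integrable (fun ω => X ω ^ (2 * m)) P := by
  have := (h.memLp ((2 * m : ℕ) : ℝ≥0)).integrable_norm_pow'
  simpa only [Real.norm_eq_abs, pow_mul, sq_abs] using this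

theorem integral_series_term_le [IsProbabilityMeasure P] (h : HasSubgaussianMoments X c P) {s : ℝ}
    (hs : 0 ≤ s) (m : ℕ) :
    ∫ ω, (s * X ω ^ 2) ^ m / (m.factorial : ℝ) ∂P ≤ (6 * c * s) ^ m := by
  rcases Nat.eq_zero_or_pos m with rfl | hm
  · simp
  · calc ∫ ω, (s * X ω ^ 2) ^ m / (m.factorial : ℝ) ∂P
        = s ^ m / (m.factorial : ℝ) * ∫ ω, X ω ^ (2 * m) ∂P := by
          rw [← integral_const_mul]
          congr 1 with ω
          rw [mul_pow, ← pow_mul]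
          ring
      _ ≤ s ^ m / (m.factorial : ℝ) * (c * (2 * m)) ^ m := by
          gcongr
          exact h.integral_pow_le m hm
      _ = (2 * c * s) ^ m * ((m : ℝ) ^ m / m.factorial) := by
          simp only [mul_pow]; ring
      _ ≤ (2 * c * s) ^ m * 3 ^ m := by
          gcongr
          rw [div_le_iff₀ (by positivity)]
          exact natCast_pow_le_three_pow_mul_factorial m
      _ = (6 * c * s) ^ m := by rw [← mul_pow]; ring

theorem hasSum_integral_series [IsProbabilityMeasure P] (h : HasSubgaussianMoments X c P) {s : ℝ}
    (hs : 0 ≤ s) (hcs : 12 * c * s ≤ 1) :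
    HasSum (fun m : ℕ => ∫ ω, (s * X ω ^ 2) ^ m / (m.factorial : ℝ) ∂P)
      (∫ ω, Real.exp (s * X ω ^ 2) ∂P) := by
  have hterm_nonneg : ∀ (m : ℕ) ω, 0 ≤ (s * X ω ^ 2) ^ m / (m.factorial : ℝ) := fun m ω => by
    positivity
  have hint : ∀ m : ℕ, Integrable (fun ω => (s * X ω ^ 2) ^ m / (m.factorial : ℝ)) P := fun m => by
    simpa only [mul_pow, ← pow_mul] using ((h.integrable_pow m).const_mul (s ^ m)).div_const _
  have hsum : Summable fun m : ℕ => ∫ ω, (s * X ω ^ 2) ^ m / (m.factorial : ℝ) ∂P :=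
    .of_nonneg_of_le (fun m => integral_nonneg (hterm_nonneg m)) (h.integral_series_term_le hs)
      (summable_geometric_of_lt_one (by positivity) (by linarith))
  have hexp : ∀ ω, ∑' m : ℕ, (s * X ω ^ 2) ^ m / (m.factorial : ℝ) = Real.exp (s * X ω ^ 2) :=
    fun ω => by rw [Real.exp_eq_exp_ℝ, NormedSpace.exp_eq_tsum_div]
  simpa only [hexp] using hasSum_integral_of_summable_integral_norm hint
    (by simpa only [Real.norm_of_nonneg (hterm_nonneg _ _)] using hsum)

theorem integrable_exp_mul_sq [IsProbabilityMeasure P] (h : HasSubgaussianMoments X c P) {s : ℝ}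
    (hs : 0 ≤ s) (hcs : 12 * c * s ≤ 1) : Integrable (fun ω => Real.exp (s * X ω ^ 2)) P := by
  -- A nonintegrable exponential would have integral `0`, but the `0`-th term of the series is `1`.
  refine .of_integral_ne_zero (ne_of_gt ?_)
  have hle := le_hasSum (h.hasSum_integral_series hs hcs) 0 fun m _ =>
    integral_nonneg fun ω => by positivity
  simp only [pow_zero, Nat.factorial_zero, Nat.cast_one, div_one, integral_const, probReal_univ,
    smul_eq_mul, mul_one] at hle
  linarith

theorem integral_exp_mul_sq_le [IsProbabilityMeasure P] (h : HasSubgaussianMoments X c P) {s : ℝ}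
    (hs : 0 ≤ s) (hcs : 12 * c * s ≤ 1) :
    ∫ ω, Real.exp (s * X ω ^ 2) ∂P ≤ Real.exp (12 * c * s) := by
  have : 6 * c * s ≤ 1 / 2 := by linarith
  have hq0 : 0 ≤ 6 * c * s := by positivity
  have hgeom : HasSum (fun m : ℕ => (6 * c * s) ^ m) (1 - 6 * c * s)⁻¹ :=
    hasSum_geometric_of_lt_one hq0 (by linarith)
  calc ∫ ω, Real.exp (s * X ω ^ 2) ∂P ≤ (1 - 6 * c * s)⁻¹ :=
        hasSum_le (h.integral_series_term_le hs) (h.hasSum_integral_series hs hcs) hgeom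
    _ ≤ 12 * c * s + 1 := by
        rw [inv_le_iff_one_le_mul₀ (by linarith)]
        nlinarith
    _ ≤ Real.exp (12 * c * s) := Real.add_one_le_exp _

theorem ae_eq_zero [IsFiniteMeasure P] (h : HasSubgaussianMoments X 0 P) : X =ᵐ[P] 0 := by
  have hzero : ∫ ω, X ω ^ (2 * 1) ∂P = 0 :=
    le_antisymm (by simpa using h.integral_pow_le 1 le_rfl)
      (integral_nonneg fun ω => (even_two_mul 1).pow_nonneg _)
  have := (integral_eq_zero_iff_of_nonneg (fun ω => (even_two_mul 1).pow_nonneg _)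
    (h.integrable_pow 1)).mp hzero
  filter_upwards [this] with ω hω
  exact eq_zero_of_pow_eq_zero hω

theorem integrable_exp_mul [IsProbabilityMeasure P] (h : HasSubgaussianMoments X c P)
    (hc : 0 < c) (t : ℝ) : Integrable (fun ω => Real.exp (t * X ω)) P := by
  refine ((h.integrable_exp_mul_sq (s := 1 / (12 * c)) (by positivity)
    (by field_simp; exact le_rfl)).const_mul (Real.exp (3 * c * t ^ 2))).mono'
    (((h.memLp 1).aestronglyMeasurable.aemeasurable.const_mul t).exp.aestronglyMeasurable)
    (.of_forall fun ω => ?_)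
  rw [Real.norm_of_nonneg (Real.exp_pos _).le]
  exact exp_mul_le_exp_mul_exp_sq hc t (X ω)

theorem mgf_le [IsProbabilityMeasure P] (h : HasSubgaussianMoments X c P) (hc : 0 < c)
    (h0 : ∫ ω, X ω ∂P = 0) (t : ℝ) : mgf X P t ≤ Real.exp (15 * c * t ^ 2) := by
  have hX : Integrable (fun ω => t * X ω) P :=
    (memLp_one_iff_integrable.mp (h.memLp 1)).const_mul t
  have : (0 : ℝ) < c := hc
  rcases le_or_gt (12 * c * t ^ 2) 1 with ht | ht
  · have hint := h.integrable_exp_mul_sq (sq_nonneg t) ht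
    calc mgf X P t ≤ ∫ ω, (t * X ω + Real.exp (t ^ 2 * X ω ^ 2)) ∂P :=
          integral_mono (h.integrable_exp_mul hc t) (hX.add hint) fun ω => by
            simpa only [mul_pow] using exp_le_add_exp_sq (t * X ω)
      _ = ∫ ω, Real.exp (t ^ 2 * X ω ^ 2) ∂P := by
          rw [integral_add hX hint, integral_const_mul, h0, mul_zero, zero_add]
      _ ≤ Real.exp (12 * c * t ^ 2) := h.integral_exp_mul_sq_le (sq_nonneg t) ht
      _ ≤ _ := Real.exp_le_exp.mpr (by nlinarith [sq_nonneg t])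
  · have hs : 12 * c * (1 / (12 * c)) = (1 : ℝ) := by field_simp
    have hs0 : (0 : ℝ) ≤ 1 / (12 * c) := by positivity
    calc mgf X P t
        ≤ ∫ ω, Real.exp (3 * c * t ^ 2) * Real.exp (1 / (12 * c) * X ω ^ 2) ∂P :=
          integral_mono (h.integrable_exp_mul hc t)
            ((h.integrable_exp_mul_sq hs0 hs.le).const_mul _)
            fun ω => exp_mul_le_exp_mul_exp_sq hc t (X ω)
      _ ≤ Real.exp (3 * c * t ^ 2) * Real.exp 1 := by
          rw [integral_const_mul]
          gcongr
          simpa only [hs] using h.integral_exp_mul_sq_le hs0 hs.le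
      _ ≤ _ := by
          rw [← Real.exp_add]
          exact Real.exp_le_exp.mpr (by linarith)

protected theorem hasSubgaussianMGF [IsProbabilityMeasure P] (h : HasSubgaussianMoments X c P)
    (h0 : ∫ ω, X ω ∂P = 0) : HasSubgaussianMGF X (30 * c) P := by
  rcases eq_zero_or_pos c with rfl | hc
  · rw [mul_zero]
    exact HasSubgaussianMGF.zero.congr h.ae_eq_zero.symm
  · refine ⟨h.integrable_exp_mul hc, fun t => (h.mgf_le hc h0 t).trans_eq ?_⟩
    push_cast
    ring_nf

theorem of_hasSubgaussianMGF [IsProbabilityMeasure P] (h : HasSubgaussianMGF X c P) :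
    HasSubgaussianMoments X (6 * c) P := by
  refine ⟨h.memLp, fun m hm => ?_⟩
  rcases eq_zero_or_pos c with rfl | hc
  · have hzero : ∫ ω, X ω ^ (2 * m) ∂P = 0 := integral_eq_zero_of_ae <| by
      filter_upwards [h.ae_eq_zero_of_hasSubgaussianMGF_zero] with ω hω
      simp [hω, show m ≠ 0 by omega]
    simp [hzero, show m ≠ 0 by omega]
  have : (0 : ℝ) < m := by exact_mod_cast hm
  have : (0 : ℝ) < c := hc
  -- `t` minimizes `exp (c t² / 2) / t^(2m)`.
  set t := √(2 * m / c)
  have ht2 : t ^ 2 = 2 * m / c := Real.sq_sqrt (by positivity)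
  have htpos : 0 < t := Real.sqrt_pos.mpr (by positivity)
  have hmgf : ∀ u : ℝ, u ^ 2 = t ^ 2 → mgf X P u ≤ 3 ^ m := fun u hu => by
    refine (h.mgf_le u).trans (Eq.trans_le ?_ (exp_natCast_le_three_pow m))
    rw [hu, ht2]
    congr 1
    field_simp
  have hi := h.integrable_exp_mul t
  have hi' := h.integrable_exp_mul (-t)
  calc ∫ ω, X ω ^ (2 * m) ∂P
      ≤ ∫ ω, ((2 * m).factorial : ℝ) / t ^ (2 * m)
          * (Real.exp (t * X ω) + Real.exp (-t * X ω)) ∂P :=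
        integral_mono_of_nonneg (.of_forall fun ω => (even_two_mul m).pow_nonneg _)
          ((hi.add hi').const_mul _)
          (.of_forall fun ω => pow_le_factorial_mul_exp_add_exp m (X ω) htpos)
    _ = ((2 * m).factorial : ℝ) / t ^ (2 * m) * (mgf X P t + mgf X P (-t)) := by
        rw [integral_const_mul, integral_add hi hi', mgf, mgf]
    _ ≤ (2 * m) ^ (2 * m) / t ^ (2 * m) * (3 ^ m + 3 ^ m) := by
        gcongr
        · exact add_nonneg mgf_nonneg mgf_nonneg
        · exact_mod_cast Nat.factorial_le_pow (2 * m)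
        · exact hmgf t rfl
        · exact hmgf (-t) (neg_sq t)
    _ = 2 * (6 * c * m) ^ m := by
        have : (2 * (m : ℝ)) ^ (2 * m) / t ^ (2 * m) = (2 * c * m) ^ m := by
          rw [pow_mul, pow_mul, ht2, ← div_pow]
          congr 1
          field_simp
        rw [this, ← two_mul, mul_left_comm, ← mul_pow]
        ring_nf
    _ ≤ 2 ^ m * (6 * c * m) ^ m := by
        gcongr
        exact le_self_pow₀ one_le_two (by omega)
    _ = _ := by
        rw [← mul_pow]
        push_cast
        ring_nf

end HasSubgaussianMoments

theorem hasSubgaussianMGF_dotProduct {ι : Type*} [Fintype ι] {X : ι → Ω → ℝ}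
    (hind : iIndepFun X P) (h : ∀ k, HasSubgaussianMGF (X k) c P) {w : ι → ℝ}
    (hw : w ⬝ᵥ w = 1) : HasSubgaussianMGF (fun ω => w ⬝ᵥ fun k => X k ω) c P := by
  have hscaled : iIndepFun (fun k ω => w k * X k ω) P :=
    hind.comp (fun k x => w k * x) fun k => measurable_const_mul (w k)
  have hterm : ∀ k, HasSubgaussianMGF (fun ω => w k * X k ω) (‖w k‖₊ ^ 2 * c) P := fun k => by
    convert (h k).const_mul (w k) using 2
    exact NNReal.eq (congrArg (· * (c : ℝ)) (sq_abs (w k)))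
  have hone : ∑ k, ‖w k‖₊ ^ 2 = 1 := by
    rw [← NNReal.coe_inj, NNReal.coe_sum, NNReal.coe_one, ← hw]
    exact Finset.sum_congr rfl fun k _ => (sq_abs (w k)).trans (sq (w k))
  have hsum := HasSubgaussianMGF.sum_of_iIndepFun hscaled (s := Finset.univ) fun k _ => hterm k
  rwa [← Finset.sum_mul, hone, one_mul] at hsum

theorem withProbAtLeast_of_measureReal_lt_le [IsProbabilityMeasure P] {N : Ω → ℝ}
    (hN : Measurable N) {t δ : ℝ} (h : P.real {ω | t < N ω} ≤ δ) :
    WithProbAtLeast P (1 - δ) fun ω => N ω ≤ t := by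
  refine ⟨{ω | N ω ≤ t}, measurableSet_le hN measurable_const, ?_, fun ω hω => hω⟩
  have hcompl := probReal_compl_eq_one_sub (μ := P) (measurableSet_lt measurable_const hN)
    (s := {ω | t < N ω})
  simp only [Set.compl_ofPred, not_lt] at hcompl
  linarith

/-- Jensen's inequality for the mean of the `Y r ^ 2` stands in for independence. -/
theorem integral_exp_sum_sq_le [IsProbabilityMeasure P] {κ : Type*} [Fintype κ] [Nonempty κ]
    {Y : κ → Ω → ℝ} (hY : ∀ r, HasSubgaussianMoments (Y r) c P) (hc : 0 < c) :
    Integrable (fun ω => Real.exp (1 / (12 * c * Fintype.card κ) * ∑ r, Y r ω ^ 2)) P ∧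
      ∫ ω, Real.exp (1 / (12 * c * Fintype.card κ) * ∑ r, Y r ω ^ 2) ∂P ≤ Real.exp 1 := by
  have : (0 : ℝ) < c := hc
  have hJ : (0 : ℝ) < Fintype.card κ := by exact_mod_cast Fintype.card_pos
  have hs : 12 * c * (1 / (12 * c)) = (1 : ℝ) := by field_simp
  have hs0 : (0 : ℝ) ≤ 1 / (12 * c) := by positivity
  have hint := fun r => (hY r).integrable_exp_mul_sq hs0 hs.le
  have hint_sum := (integrable_finsetSum Finset.univ fun r _ => hint r).const_mul
    (1 / (Fintype.card κ : ℝ))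
  have hjensen : ∀ ω, Real.exp (1 / (12 * c * Fintype.card κ) * ∑ r, Y r ω ^ 2)
      ≤ 1 / Fintype.card κ * ∑ r, Real.exp (1 / (12 * c) * Y r ω ^ 2) := fun ω => by
    have := convexOn_exp.map_sum_le (t := Finset.univ) (w := fun _ : κ => 1 / (Fintype.card κ : ℝ))
      (p := fun r => 1 / (12 * c) * Y r ω ^ 2) (fun _ _ => by positivity)
      (by simp [hJ.ne']) fun _ _ => Set.mem_univ _
    simp only [smul_eq_mul, ← Finset.mul_sum] at this
    refine (congrArg Real.exp ?_).trans_le this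
    rw [← mul_assoc]
    congr 1
    field_simp
  have hint_exp : Integrable
      (fun ω => Real.exp (1 / (12 * c * Fintype.card κ) * ∑ r, Y r ω ^ 2)) P := by
    refine hint_sum.mono' ?_ (.of_forall fun ω => ?_)
    · have := fun r => ((hY r).memLp 1).aestronglyMeasurable.aemeasurable
      exact (by fun_prop : AEMeasurable _ P).aestronglyMeasurable
    · rw [Real.norm_of_nonneg (Real.exp_pos _).le]
      exact hjensen ω
  refine ⟨hint_exp, (integral_mono hint_exp hint_sum hjensen).trans ?_⟩
  rw [integral_const_mul, integral_finsetSum _ fun r _ => hint r, one_div_mul_eq_div,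
    div_le_iff₀' hJ, ← nsmul_eq_mul]
  refine Finset.sum_le_card_nsmul _ _ _ fun r _ => ?_
  simpa only [hs] using (hY r).integral_exp_mul_sq_le hs0 hs.le

theorem withProbAtLeast_sum_sq_le [IsProbabilityMeasure P] {κ : Type*} [Fintype κ]
    {Y : κ → Ω → ℝ} (hY : ∀ r, Measurable (Y r)) (h : ∀ r, HasSubgaussianMoments (Y r) c P)
    {δ : ℝ} (hδ : 0 < δ) (hδ1 : 1 ≤ Real.log (1 / δ)) :
    WithProbAtLeast P (1 - δ) fun ω =>
      ∑ r, Y r ω ^ 2 ≤ 24 * c * Fintype.card κ * Real.log (1 / δ) := by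
  set N : Ω → ℝ := fun ω => ∑ r, Y r ω ^ 2
  set J : ℝ := (Fintype.card κ : ℝ) with hJ_def
  refine withProbAtLeast_of_measureReal_lt_le
    (Finset.measurable_fun_sum _ fun r _ => (hY r).pow_const 2) ?_
  rcases isEmpty_or_nonempty κ with hκ | hκ
  · simpa [hJ_def] using hδ.le
  rcases eq_zero_or_pos c with rfl | hc
  · have hzero : ∀ᵐ ω ∂P, ∀ r, Y r ω = 0 := ae_all_iff.mpr fun r => (h r).ae_eq_zero
    have hnull : P {ω | 24 * ((0 : ℝ≥0) : ℝ) * J * Real.log (1 / δ) < N ω} = 0 :=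
      measure_eq_zero_iff_ae_notMem.mpr <| by
        filter_upwards [hzero] with ω hω
        simp [N, hω]
    rw [measureReal_def, hnull]
    exact hδ.le
  have : (0 : ℝ) < c := hc
  have hJ : 0 < J := Nat.cast_pos.mpr Fintype.card_pos
  obtain ⟨hint, hexp⟩ := integral_exp_sum_sq_le h hc
  calc P.real {ω | 24 * c * J * Real.log (1 / δ) < N ω}
      ≤ P.real {ω | 24 * c * J * Real.log (1 / δ) ≤ N ω} :=
        measureReal_mono fun ω (hω : _ < N ω) => hω.le
    _ ≤ Real.exp (-(1 / (12 * c * J)) * (24 * c * J * Real.log (1 / δ)))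
          * mgf N P (1 / (12 * c * J)) :=
        measure_ge_le_exp_mul_mgf _ (by positivity) hint
    _ ≤ Real.exp (-(2 * Real.log (1 / δ))) * Real.exp 1 := by
        refine mul_le_mul (Real.exp_le_exp.mpr (le_of_eq ?_)) ?_ mgf_nonneg (Real.exp_pos _).le
        · field_simp
          norm_num
        · exact hexp
    _ ≤ Real.exp (-Real.log (1 / δ)) := by
        rw [← Real.exp_add]
        exact Real.exp_le_exp.mpr (by linarith)
    _ = δ := by rw [one_div, Real.log_inv, neg_neg, Real.exp_log hδ]

end SubgaussianMoments

/-! ### The subgaussian norm -/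

section SubgaussianNorm

variable {Ω : Type*} [MeasurableSpace Ω] {P : Measure Ω} {X : Ω → ℝ}

theorem psiTwoNorm_nonneg : 0 ≤ psiTwoNorm P X := by
  refine Real.iSup_nonneg fun q => mul_nonneg (Real.rpow_nonneg (zero_le_one.trans q.2) _) ?_
  exact Real.rpow_nonneg (integral_nonneg fun ω => Real.rpow_nonneg (abs_nonneg _) _) _

theorem psiTwoNorm_term_le_one [IsProbabilityMeasure P] (hX : ∀ᵐ ω ∂P, |X ω| ≤ 1)
    (q : Set.Ici (1 : ℝ)) :
    (q : ℝ) ^ (-(1 / 2) : ℝ) * (∫ ω, |X ω| ^ (q : ℝ) ∂P) ^ (1 / (q : ℝ)) ≤ 1 := by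
  have hq : (1 : ℝ) ≤ q := q.2
  have hmoment_nonneg : 0 ≤ ∫ ω, |X ω| ^ (q : ℝ) ∂P :=
    integral_nonneg fun ω => Real.rpow_nonneg (abs_nonneg _) _
  have hmoment_le : ∫ ω, |X ω| ^ (q : ℝ) ∂P ≤ 1 :=
    (integral_mono_of_nonneg (.of_forall fun ω => Real.rpow_nonneg (abs_nonneg _) _)
      (integrable_const 1) (hX.mono fun ω hω =>
        Real.rpow_le_one (abs_nonneg _) hω (zero_le_one.trans hq))).trans_eq (by simp)
  exact mul_le_one₀ (Real.rpow_le_one_of_one_le_of_nonpos hq (by norm_num))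
    (Real.rpow_nonneg hmoment_nonneg _)
    (Real.rpow_le_one hmoment_nonneg hmoment_le (by positivity))

theorem psiTwoNorm_le_one [IsProbabilityMeasure P] (hX : ∀ᵐ ω ∂P, |X ω| ≤ 1) :
    psiTwoNorm P X ≤ 1 :=
  haveI : Nonempty (Set.Ici (1 : ℝ)) := ⟨⟨1, Set.self_mem_Ici⟩⟩
  ciSup_le (psiTwoNorm_term_le_one hX)

theorem integral_pow_le_psiTwoNorm [IsProbabilityMeasure P] (hX : ∀ᵐ ω ∂P, |X ω| ≤ 1) {m : ℕ}
    (hm : 1 ≤ m) : ∫ ω, X ω ^ (2 * m) ∂P ≤ (psiTwoNorm P X ^ 2 * (2 * m)) ^ m := by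
  have hq : (1 : ℝ) ≤ ((2 * m : ℕ) : ℝ) := by exact_mod_cast (by omega : 1 ≤ 2 * m)
  have hle := le_ciSup (f := fun q : Set.Ici (1 : ℝ) =>
      (q : ℝ) ^ (-(1 / 2) : ℝ) * (∫ ω, |X ω| ^ (q : ℝ) ∂P) ^ (1 / (q : ℝ)))
    ⟨1, Set.forall_mem_range.mpr (psiTwoNorm_term_le_one hX)⟩ ⟨((2 * m : ℕ) : ℝ), hq⟩
  change _ ≤ psiTwoNorm P X at hle
  simp only [Real.rpow_natCast, pow_mul, sq_abs] at hle
  simp only [← pow_mul] at hle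
  have hmoment_nonneg : 0 ≤ ∫ ω, X ω ^ (2 * m) ∂P :=
    integral_nonneg fun ω => (even_two_mul m).pow_nonneg _
  have hpow := pow_le_pow_left₀ (by positivity) hle (2 * m)
  have hexp : (-(1 / 2) : ℝ) * ((2 * m : ℕ) : ℝ) = -(m : ℝ) := by push_cast; ring
  rw [mul_pow, one_div ((2 * m : ℕ) : ℝ), Real.rpow_inv_natCast_pow hmoment_nonneg (by omega),
    ← Real.rpow_natCast, ← Real.rpow_mul (by positivity), hexp, Real.rpow_neg (by positivity),
    Real.rpow_natCast, inv_mul_le_iff₀ (by positivity)] at hpow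
  refine hpow.trans_eq ?_
  rw [pow_mul, ← mul_pow]
  push_cast
  ring

end SubgaussianNorm

section Bernoulli

variable {q : ℝ}

theorem isProbabilityMeasure_bernoulliLaw (hq : q ∈ Set.Icc (0 : ℝ) 1) :
    IsProbabilityMeasure (bernoulliLaw q) := by
  refine ⟨?_⟩
  simp only [bernoulliLaw, Measure.add_apply, Measure.smul_apply, measure_univ, smul_eq_mul,
    mul_one]
  rw [← ENNReal.ofReal_add hq.1 (sub_nonneg.mpr hq.2), add_sub_cancel, ENNReal.ofReal_one]

theorem integral_bernoulliLaw (hq : q ∈ Set.Icc (0 : ℝ) 1) (φ : ℝ → ℝ) :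
    ∫ x, φ x ∂(bernoulliLaw q) = q * φ 1 + (1 - q) * φ 0 := by
  have hd : ∀ a : ℝ, Integrable φ (Measure.dirac a) := fun a => integrable_dirac (by simp)
  rw [bernoulliLaw, integral_add_measure ((hd 1).smul_measure ENNReal.ofReal_ne_top)
    ((hd 0).smul_measure ENNReal.ofReal_ne_top), integral_smul_measure, integral_smul_measure,
    integral_dirac, integral_dirac, ENNReal.toReal_ofReal hq.1,
    ENNReal.toReal_ofReal (sub_nonneg.mpr hq.2), smul_eq_mul, smul_eq_mul]

theorem ae_abs_sub_le_one_bernoulliLaw (hq : q ∈ Set.Icc (0 : ℝ) 1) :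
    ∀ᵐ x ∂(bernoulliLaw q), |x - q| ≤ 1 := by
  have hmeas : MeasurableSet {x : ℝ | |x - q| ≤ 1} :=
    measurableSet_le (by fun_prop) measurable_const
  rw [bernoulliLaw, ae_add_measure_iff]
  constructor <;> refine Measure.ae_smul_measure ((ae_dirac_iff hmeas).mpr (abs_le.mpr ?_)) _ <;>
    constructor <;> linarith [hq.1, hq.2]

theorem bernoulliNorm_nonneg (q : ℝ) : 0 ≤ bernoulliNorm q :=
  psiTwoNorm_nonneg

theorem bernoulliNorm_le_one (hq : q ∈ Set.Icc (0 : ℝ) 1) : bernoulliNorm q ≤ 1 :=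
  haveI := isProbabilityMeasure_bernoulliLaw hq
  psiTwoNorm_le_one (ae_abs_sub_le_one_bernoulliLaw hq)

theorem bernoulli_moment_le (hq : q ∈ Set.Icc (0 : ℝ) 1) {m : ℕ} (hm : 1 ≤ m) :
    q * (1 - q) ^ (2 * m) + (1 - q) * q ^ (2 * m) ≤ (bernoulliNorm q ^ 2 * (2 * m)) ^ m := by
  have := isProbabilityMeasure_bernoulliLaw hq
  refine Eq.trans_le ?_ (integral_pow_le_psiTwoNorm (ae_abs_sub_le_one_bernoulliLaw hq) hm)
  rw [integral_bernoulliLaw hq fun x => (x - q) ^ (2 * m), zero_sub, (even_two_mul m).neg_pow]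

end Bernoulli

/-! ### One observation -/

section UniformCircle

instance : IsProbabilityMeasure
    (ProbabilityTheory.cond (volume : Measure ℝ) (Set.Ico 0 (2 * Real.pi))) :=
  cond_isProbabilityMeasure_of_finite (by simp [Real.pi_pos])
    (by rw [Real.volume_Ico]; exact ENNReal.ofReal_ne_top)

theorem measurable_exp_mul_I : Measurable fun φ : ℝ => Complex.exp (φ * Complex.I) :=
  Continuous.measurable (by fun_prop)

instance : IsProbabilityMeasure uniformCircle :=
  Measure.isProbabilityMeasure_map measurable_exp_mul_I.aemeasurable

theorem ae_norm_uniformCircle : ∀ᵐ u ∂uniformCircle, ‖u‖ = 1 := by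
  rw [uniformCircle, ae_map_iff measurable_exp_mul_I.aemeasurable
    (measurableSet_eq_fun measurable_norm measurable_const)]
  exact .of_forall fun φ => Complex.norm_exp_ofReal_mul_I φ

theorem integrable_uniformCircle {E : Type*} [NormedAddCommGroup E] {φ : ℂ → E}
    (hφ : Continuous φ) : Integrable φ uniformCircle := by
  obtain ⟨C, hC⟩ := (isCompact_sphere (0 : ℂ) 1).exists_bound_of_continuousOn hφ.continuousOn
  refine Integrable.of_bound hφ.aestronglyMeasurable C ?_
  filter_upwards [ae_norm_uniformCircle] with u hu
  exact hC u (by simpa using hu)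

theorem integral_id_uniformCircle : ∫ u, u ∂uniformCircle = 0 := by
  have hcircle : ∫ x in (0 : ℝ)..(2 * Real.pi), Complex.exp (x * Complex.I) = 0 := by
    simp only [mul_comm _ Complex.I]
    rw [integral_exp_mul_complex Complex.I_ne_zero]
    simp [mul_comm Complex.I, Complex.exp_two_pi_mul_I]
  rw [uniformCircle, integral_map measurable_exp_mul_I.aemeasurable
      continuous_id'.aestronglyMeasurable,
    ProbabilityTheory.cond, integral_smul_measure, integral_Ico_eq_integral_Ioc,
    ← intervalIntegral.integral_of_le (by positivity), hcircle, smul_zero]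

theorem integral_clm_uniformCircle (l : ℂ →L[ℝ] ℝ) : ∫ u, l u ∂uniformCircle = 0 := by
  rw [l.integral_comp_comm (integrable_uniformCircle continuous_id'),
    integral_id_uniformCircle, map_zero]

end UniformCircle

section EntryMoments

variable {η p R : ℝ} {m : ℕ}

theorem one_sub_mul_pow_le (hη : η ∈ Set.Icc (0 : ℝ) 1) (hp : p ∈ Set.Icc (0 : ℝ) 1) (m : ℕ) :
    (1 - (1 - η) * p) ^ (2 * m) ≤ 4 ^ m * ((1 - p) ^ (2 * m) + η ^ (2 * m)) := by
  obtain ⟨hη0, _⟩ := hη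
  obtain ⟨hp0, hp1⟩ := hp
  calc (1 - (1 - η) * p) ^ (2 * m) ≤ ((1 - p) + η) ^ (2 * m) :=
        pow_le_pow_left₀ (by nlinarith) (by nlinarith) _
    _ ≤ 2 ^ (2 * m - 1) * ((1 - p) ^ (2 * m) + η ^ (2 * m)) :=
        add_pow_le (sub_nonneg.mpr hp1) hη0 _
    _ ≤ 2 ^ (2 * m) * ((1 - p) ^ (2 * m) + η ^ (2 * m)) := by
        have := sub_nonneg.mpr hp1
        gcongr
        · exact one_le_two
        · omega
    _ = _ := by rw [pow_mul]; norm_num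

theorem le_four_pow_mul_of_moment_le (hη : η ∈ Set.Icc (0 : ℝ) 1)
    (hηR : η * (1 - η) ^ (2 * m) + (1 - η) * η ^ (2 * m) ≤ R) (hR : η ^ (2 * m) ≤ R) :
    η ≤ 4 ^ m * R := by
  obtain ⟨hη0, hη1⟩ := hη
  have := sub_nonneg.mpr hη1
  rcases le_or_gt η (1 / 2) with h | h
  · have hone : (1 : ℝ) ≤ 4 ^ m * (1 - η) ^ (2 * m) := by
      rw [pow_mul, ← mul_pow]
      exact one_le_pow₀ (by nlinarith)
    calc η ≤ η * (4 ^ m * (1 - η) ^ (2 * m)) := le_mul_of_one_le_right hη0 hone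
      _ = 4 ^ m * (η * (1 - η) ^ (2 * m)) := by ring
      _ ≤ 4 ^ m * R := by
          gcongr
          exact (le_add_of_nonneg_right (by positivity)).trans hηR
  · calc η ≤ 1 := hη1
      _ ≤ (4 * η ^ 2) ^ m := one_le_pow₀ (by nlinarith)
      _ = 4 ^ m * η ^ (2 * m) := by rw [mul_pow, ← pow_mul]
      _ ≤ _ := by gcongr

/-- The three summands are the contributions of a correct, an outlying and a missing
observation. -/
theorem entry_moments_le (hη : η ∈ Set.Icc (0 : ℝ) 1) (hp : p ∈ Set.Icc (0 : ℝ) 1)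
    (hpR : p * (1 - p) ^ (2 * m) + (1 - p) * p ^ (2 * m) ≤ R)
    (hηR : η * (1 - η) ^ (2 * m) + (1 - η) * η ^ (2 * m) ≤ R) (hR : η ^ (2 * m) ≤ R)
    (hm : 1 ≤ m) :
    (1 - η) * p * (1 - (1 - η) * p) ^ (2 * m) + η * p * 4 ^ m
      + (1 - p) * ((1 - η) * p) ^ (2 * m) ≤ 48 ^ m * R := by
  have hη' : 0 ≤ 1 - η := sub_nonneg.mpr hη.2
  have hp' : 0 ≤ 1 - p := sub_nonneg.mpr hp.2
  have hp0 : 0 ≤ p := hp.1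
  have hR0 : 0 ≤ R := ((even_two_mul m).pow_nonneg η).trans hR
  have hd : (1 - η) * p ≤ p := mul_le_of_le_one_left hp0 (sub_le_self 1 hη.1)
  have hcorrect : (1 - η) * p * (1 - (1 - η) * p) ^ (2 * m)
      ≤ 4 ^ m * (p * (1 - p) ^ (2 * m)) + 4 ^ m * R := by
    calc (1 - η) * p * (1 - (1 - η) * p) ^ (2 * m)
        ≤ p * (4 ^ m * ((1 - p) ^ (2 * m) + η ^ (2 * m))) :=
          mul_le_mul hd (one_sub_mul_pow_le hη hp m) ((even_two_mul m).pow_nonneg _) hp0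
      _ = 4 ^ m * (p * (1 - p) ^ (2 * m)) + p * (4 ^ m * η ^ (2 * m)) := by ring
      _ ≤ 4 ^ m * (p * (1 - p) ^ (2 * m)) + 1 * (4 ^ m * R) := by
          have := (even_two_mul m).pow_nonneg η
          gcongr
          exact hp.2
      _ = _ := by rw [one_mul]
  have houtlier : η * p * 4 ^ m ≤ 16 ^ m * R := by
    calc η * p * 4 ^ m ≤ η * 4 ^ m := by
          gcongr
          exact mul_le_of_le_one_right hη.1 hp.2
      _ ≤ 4 ^ m * R * 4 ^ m := by
          gcongr
          exact le_four_pow_mul_of_moment_le hη hηR hR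
      _ = 16 ^ m * R := by
          rw [mul_right_comm, ← mul_pow]
          norm_num
  have hmissing : (1 - p) * ((1 - η) * p) ^ (2 * m) ≤ 4 ^ m * ((1 - p) * p ^ (2 * m)) := by
    calc (1 - p) * ((1 - η) * p) ^ (2 * m) ≤ (1 - p) * p ^ (2 * m) := by gcongr
      _ ≤ _ := le_mul_of_one_le_left (by positivity) (one_le_pow₀ (by norm_num))
  have hpR4 : 4 ^ m * (p * (1 - p) ^ (2 * m)) + 4 ^ m * ((1 - p) * p ^ (2 * m)) ≤ 4 ^ m * R := by
    rw [← mul_add]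
    gcongr
  have h416 : (4 : ℝ) ^ m * R ≤ 16 ^ m * R := by gcongr; norm_num
  calc _ ≤ 3 * (16 ^ m * R) := by linarith
    _ ≤ 3 ^ m * (16 ^ m * R) := by
        gcongr
        exact le_self_pow₀ (by norm_num) (by omega)
    _ = 48 ^ m * R := by rw [← mul_assoc, ← mul_pow]; norm_num

end EntryMoments

section EntryLaw

open scoped NNReal

variable {η p : ℝ} {z : ℂ}

theorem integral_entryLaw (hη : η ∈ Set.Icc (0 : ℝ) 1) (hp : p ∈ Set.Icc (0 : ℝ) 1) {φ : ℂ → ℝ}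
    (hφ : Continuous φ) :
    ∫ a, φ a ∂(entryLaw η p z)
      = (1 - η) * p * φ z + η * p * ∫ u, φ u ∂uniformCircle + (1 - p) * φ 0 := by
  have hdirac : ∀ a : ℂ, Integrable φ (Measure.dirac a) := fun a => integrable_dirac (by simp)
  have hcorrect := (hdirac z).smul_measure (ENNReal.ofReal_ne_top (r := (1 - η) * p))
  have houtlier := (integrable_uniformCircle hφ).smul_measure
    (ENNReal.ofReal_ne_top (r := η * p))
  have hmissing := (hdirac 0).smul_measure (ENNReal.ofReal_ne_top (r := 1 - p))
  rw [entryLaw, integral_add_measure (hcorrect.add_measure houtlier) hmissing,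
    integral_add_measure hcorrect houtlier]
  simp only [integral_smul_measure, integral_dirac, smul_eq_mul]
  rw [ENNReal.toReal_ofReal (mul_nonneg (sub_nonneg.mpr hη.2) hp.1),
    ENNReal.toReal_ofReal (mul_nonneg hη.1 hp.1), ENNReal.toReal_ofReal (sub_nonneg.mpr hp.2)]

theorem ae_norm_entryLaw_le (hz : ‖z‖ = 1) : ∀ᵐ a ∂(entryLaw η p z), ‖a‖ ≤ 1 := by
  have hdirac : ∀ b : ℂ, ‖b‖ ≤ 1 → ∀ᵐ a ∂(Measure.dirac b), ‖a‖ ≤ 1 := fun b hb =>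
    (ae_dirac_iff (measurableSet_le measurable_norm measurable_const)).mpr hb
  rw [entryLaw, ae_add_measure_iff, ae_add_measure_iff]
  exact ⟨⟨Measure.ae_smul_measure (hdirac z hz.le) _,
    Measure.ae_smul_measure (ae_norm_uniformCircle.mono fun u hu => hu.le) _⟩,
    Measure.ae_smul_measure (hdirac 0 (by simp)) _⟩

theorem integral_clm_sub_entryLaw (hη : η ∈ Set.Icc (0 : ℝ) 1) (hp : p ∈ Set.Icc (0 : ℝ) 1)
    (l : ℂ →L[ℝ] ℝ) : ∫ a, l (a - ((1 - η) * p) • z) ∂(entryLaw η p z) = 0 := by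
  rw [integral_entryLaw hη hp (by fun_prop)]
  simp only [map_sub, map_smul, smul_eq_mul, map_zero]
  rw [integral_sub (integrable_uniformCircle l.continuous) (integrable_const _),
    integral_clm_uniformCircle, integral_const, probReal_univ, one_smul]
  ring

theorem clm_pow_le {l : ℂ →L[ℝ] ℝ} (hl : ‖l‖ ≤ 1) {x : ℂ} {B : ℝ} (hx : ‖x‖ ≤ B) (m : ℕ) :
    l x ^ (2 * m) ≤ B ^ (2 * m) := by
  rw [← (even_two_mul m).pow_abs]
  exact pow_le_pow_left₀ (abs_nonneg _)
    ((l.le_of_opNorm_le hl x).trans ((one_mul _).trans_le hx)) _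

theorem integral_clm_sub_pow_entryLaw_le (hη : η ∈ Set.Icc (0 : ℝ) 1)
    (hp : p ∈ Set.Icc (0 : ℝ) 1) (hz : ‖z‖ = 1) {l : ℂ →L[ℝ] ℝ} (hl : ‖l‖ ≤ 1) (m : ℕ) :
    ∫ a, l (a - ((1 - η) * p) • z) ^ (2 * m) ∂(entryLaw η p z)
      ≤ (1 - η) * p * (1 - (1 - η) * p) ^ (2 * m) + η * p * 4 ^ m
        + (1 - p) * ((1 - η) * p) ^ (2 * m) := by
  have hη' : 0 ≤ 1 - η := sub_nonneg.mpr hη.2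
  have hp' : 0 ≤ 1 - p := sub_nonneg.mpr hp.2
  have hd : 0 ≤ (1 - η) * p := mul_nonneg hη' hp.1
  have hd1 : (1 - η) * p ≤ 1 := mul_le_one₀ (sub_le_self 1 hη.1) hp.1 hp.2
  have hnorm : ‖((1 - η) * p) • z‖ = (1 - η) * p := by
    rw [norm_smul, hz, mul_one, Real.norm_of_nonneg hd]
  have hcorrect : ‖z - ((1 - η) * p) • z‖ ≤ 1 - (1 - η) * p := by
    rw [← one_smul ℝ z, smul_smul, ← sub_smul, mul_one, norm_smul, hz, mul_one,
      Real.norm_of_nonneg (sub_nonneg.mpr hd1)]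
  have houtlier : ∫ u, l (u - ((1 - η) * p) • z) ^ (2 * m) ∂uniformCircle ≤ 4 ^ m := by
    have hae : ∀ᵐ u ∂uniformCircle, l (u - ((1 - η) * p) • z) ^ (2 * m) ≤ 4 ^ m := by
      filter_upwards [ae_norm_uniformCircle] with u hu
      have hu2 : ‖u - ((1 - η) * p) • z‖ ≤ 2 := (norm_sub_le _ _).trans (by linarith)
      exact (clm_pow_le hl hu2 m).trans_eq (by rw [pow_mul]; norm_num)
    exact (integral_mono_ae (integrable_uniformCircle
      (φ := fun u => l (u - ((1 - η) * p) • z) ^ (2 * m)) (by fun_prop))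
      (integrable_const _) hae).trans_eq (by simp)
  have hmissing : ‖0 - ((1 - η) * p) • z‖ ≤ (1 - η) * p := by
    rw [zero_sub, norm_neg, hnorm]
  rw [integral_entryLaw hη hp (φ := fun a => l (a - ((1 - η) * p) • z) ^ (2 * m)) (by fun_prop)]
  exact add_le_add (add_le_add (mul_le_mul_of_nonneg_left (clm_pow_le hl hcorrect m) hd)
    (mul_le_mul_of_nonneg_left houtlier (mul_nonneg hη.1 hp.1)))
    (mul_le_mul_of_nonneg_left (clm_pow_le hl hmissing m) hp')

theorem hasSubgaussianMoments_entryLaw [IsProbabilityMeasure (entryLaw η p z)]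
    (hη : η ∈ Set.Icc (0 : ℝ) 1) (hp : p ∈ Set.Icc (0 : ℝ) 1) (hz : ‖z‖ = 1) {l : ℂ →L[ℝ] ℝ}
    (hl : ‖l‖ ≤ 1) {Q : ℝ≥0} (hηQ : η ≤ Q) (hnη : bernoulliNorm η ≤ Q) (hnp : bernoulliNorm p ≤ Q) :
    HasSubgaussianMoments (fun a => l (a - ((1 - η) * p) • z)) (48 * Q ^ 2) (entryLaw η p z) where
  memLp q := by
    refine MemLp.of_bound (Continuous.aestronglyMeasurable (by fun_prop))
      (1 + ‖((1 - η) * p) • z‖) ?_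
    filter_upwards [ae_norm_entryLaw_le hz] with a ha
    exact (l.le_of_opNorm_le hl _).trans
      (by rw [one_mul]; exact (norm_sub_le _ _).trans (by gcongr))
  integral_pow_le m hm := by
    have hm1 : (1 : ℝ) ≤ 2 * m := by exact_mod_cast (by omega : 1 ≤ 2 * m)
    have hmono : ∀ x : ℝ, 0 ≤ x → x ≤ Q → (x ^ 2 * (2 * m)) ^ m ≤ (Q ^ 2 * (2 * m) : ℝ) ^ m :=
      fun x hx hxQ => by gcongr
    have hηR : η ^ (2 * m) ≤ (Q ^ 2 * (2 * m) : ℝ) ^ m := by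
      refine le_trans ?_ (hmono η hη.1 hηQ)
      rw [pow_mul]
      gcongr
      exact le_mul_of_one_le_right (sq_nonneg _) hm1
    calc ∫ a, l (a - ((1 - η) * p) • z) ^ (2 * m) ∂(entryLaw η p z)
        ≤ _ := integral_clm_sub_pow_entryLaw_le hη hp hz hl m
      _ ≤ 48 ^ m * (Q ^ 2 * (2 * m) : ℝ) ^ m := entry_moments_le hη hp
          ((bernoulli_moment_le hp hm).trans (hmono _ (bernoulliNorm_nonneg _) hnp))
          ((bernoulli_moment_le hη hm).trans (hmono _ (bernoulliNorm_nonneg _) hnη)) hηR hm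
      _ = _ := by push_cast; rw [← mul_pow, mul_assoc]

end EntryLaw

/-! ### The projected noise -/

section Noise

open scoped NNReal

variable {n T : ℕ} {Ω : Type*} [MeasurableSpace Ω] {P : Measure Ω} {η : ℝ} {p : Fin T → ℝ}
  {g : Fin T → Fin n → ℂ}

/-- The deviation `A - D Ḡ*` of the stacked observations from their expectation. -/
noncomputable def noise (η : ℝ) (p : Fin T → ℝ) (g : Fin T → Fin n → ℂ)
    (A : Fin T → Matrix (Fin n) (Fin n) ℂ) : Matrix (Fin T × Fin n) (Fin n) ℂ :=
  stack A - dMat n η p * gBar g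

theorem noise_apply (A : Fin T → Matrix (Fin n) (Fin n) ℂ) (k : Fin T) (i j : Fin n) :
    noise η p g A (k, i) j
      = A k i j - ((1 - η) * p k) • (g k i * star (g k j) - if i = j then 1 else 0) := by
  simp only [noise, dMat, gBar, stack, Matrix.diagonal_mul, Matrix.sub_apply,
    Matrix.vecMulVec_apply, Pi.star_apply, Matrix.one_apply, Complex.real_smul]

theorem card_lowFreq_le (T τ : ℕ) : Fintype.card {l : Fin T // T ≤ l.val + τ} ≤ τ := by
  have hinj : Function.Injective fun l : {l : Fin T // T ≤ l.val + τ} =>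
      (⟨T - 1 - l.1.val, by have := l.1.isLt; have := l.2; omega⟩ : Fin τ) := by
    intro a b hab
    simp only [Fin.mk.injEq] at hab
    ext
    have := a.1.isLt
    have := b.1.isLt
    omega
  simpa using Fintype.card_le_of_injective _ hinj

namespace IsOutliersModel

variable {A : Ω → Fin T → Matrix (Fin n) (Fin n) ℂ}

theorem noise_diag (hA : IsOutliersModel P η p g A) (hg : ∀ k i, ‖g k i‖ = 1) (ω : Ω) (k : Fin T)
    (i : Fin n) : noise η p g (A ω) (k, i) i = 0 := by
  rw [noise_apply, hA.diag, RCLike.star_def, Complex.mul_conj', hg]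
  simp

theorem star_noise (hA : IsOutliersModel P η p g A) (ω : Ω) (k : Fin T) (i j : Fin n) :
    star (noise η p g (A ω) (k, i) j) = noise η p g (A ω) (k, j) i := by
  have hobs : star (A ω k i j) = A ω k j i := (hA.hermitian ω k).apply j i
  simp only [noise_apply, star_sub, hobs, Complex.real_smul, star_mul',
    RCLike.star_def, Complex.conj_ofReal, mul_comm (g k j), apply_ite (starRingEnd ℂ), map_one,
    map_zero, eq_comm (a := j)]
  simp

theorem hasSubgaussianMGF_noise [IsProbabilityMeasure P] (hA : IsOutliersModel P η p g A)
    (hη : η ∈ Set.Icc (0 : ℝ) 1) (hp : ∀ k, p k ∈ Set.Icc (0 : ℝ) 1) (hg : ∀ k i, ‖g k i‖ = 1)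
    {Q : ℝ≥0} (hηQ : η ≤ Q) (hnη : bernoulliNorm η ≤ Q) (hnp : ∀ k, bernoulliNorm (p k) ≤ Q)
    {l : ℂ →L[ℝ] ℝ} (hl : ‖l‖ ≤ 1) {i j : Fin n} (hij : i < j) (k : Fin T) :
    HasSubgaussianMGF (fun ω => l (noise η p g (A ω) (k, i) j)) (30 * (48 * Q ^ 2)) P := by
  have hz : ‖g k i * star (g k j)‖ = 1 := by rw [norm_mul, norm_star, hg, hg, one_mul]
  have : IsProbabilityMeasure (entryLaw η (p k) (g k i * star (g k j))) :=
    hA.law k i j hij ▸ Measure.isProbabilityMeasure_map (hA.measurable k i j).aemeasurable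
  have hlaw := (hasSubgaussianMoments_entryLaw hη (hp k) hz hl hηQ hnη (hnp k)).hasSubgaussianMGF
    (integral_clm_sub_entryLaw hη (hp k) l)
  rw [← hA.law k i j hij] at hlaw
  simpa only [noise_apply, if_neg hij.ne, sub_zero, Function.comp_def] using
    hlaw.of_map (hA.measurable k i j).aemeasurable

theorem iIndepFun_noise (hA : IsOutliersModel P η p g A) (l : ℂ →L[ℝ] ℝ) {i j : Fin n}
    (hij : i < j) : iIndepFun (fun k ω => l (noise η p g (A ω) (k, i) j)) P := by
  simp only [noise_apply]
  have hentry := hA.indep.precomp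
    (g := fun k : Fin T => (⟨(k, i, j), hij⟩ : {e : Fin T × Fin n × Fin n // e.2.1 < e.2.2}))
    fun a b hab => by simpa using hab
  exact hentry.comp
    (fun k a => l (a - ((1 - η) * p k) • (g k i * star (g k j) - if i = j then 1 else 0)))
    fun k => Continuous.measurable (by fun_prop)

/-- The diagonal of the noise vanishes, and an entry below it is conjugate to one above it. -/
theorem hasSubgaussianMoments_dotProduct_noise [IsProbabilityMeasure P]
    (hA : IsOutliersModel P η p g A) (hη : η ∈ Set.Icc (0 : ℝ) 1)
    (hp : ∀ k, p k ∈ Set.Icc (0 : ℝ) 1) (hg : ∀ k i, ‖g k i‖ = 1) {Q : ℝ≥0} (hηQ : η ≤ Q)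
    (hnη : bernoulliNorm η ≤ Q) (hnp : ∀ k, bernoulliNorm (p k) ≤ Q) {l : ℂ →L[ℝ] ℝ}
    (hl : ‖l‖ ≤ 1) {w : Fin T → ℝ} (hw : w ⬝ᵥ w = 1) (i j : Fin n) :
    HasSubgaussianMoments (fun ω => w ⬝ᵥ fun k => l (noise η p g (A ω) (k, i) j))
      (6 * (30 * (48 * Q ^ 2))) P := by
  have habove : ∀ {l : ℂ →L[ℝ] ℝ}, ‖l‖ ≤ 1 → ∀ {i j : Fin n}, i < j →
      HasSubgaussianMoments (fun ω => w ⬝ᵥ fun k => l (noise η p g (A ω) (k, i) j))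
        (6 * (30 * (48 * Q ^ 2))) P := fun hl _ _ hij =>
    .of_hasSubgaussianMGF <| hasSubgaussianMGF_dotProduct (hA.iIndepFun_noise _ hij)
      (hA.hasSubgaussianMGF_noise hη hp hg hηQ hnη hnp hl hij) hw
  rcases lt_trichotomy i j with hij | rfl | hij
  · exact habove hl hij
  · simp only [hA.noise_diag hg, map_zero, dotProduct, mul_zero, Finset.sum_const_zero]
    exact .zero _
  · have hconj : ‖l.comp (Complex.conjCLE : ℂ →L[ℝ] ℂ)‖ ≤ 1 :=
      (l.opNorm_comp_le _).trans (by rwa [Complex.conjCLE_norm, mul_one])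
    simpa only [ContinuousLinearMap.comp_apply, ContinuousLinearEquiv.coe_coe,
      Complex.conjCLE_apply, ← RCLike.star_def, hA.star_noise] using habove hconj hij

theorem frobSq_proj_mul_noise_eq_sum {v : Fin T → Fin T → ℝ} (hv : IsPathEigenbasis v) (τ : ℕ)
    (B : Fin T → Matrix (Fin n) (Fin n) ℂ) :
    frobSq (proj n v τ * noise η p g B)
      = ∑ r : (Fin n × Fin n) × {l : Fin T // T ≤ l.val + τ} × Bool,
          (v r.2.1.1 ⬝ᵥ fun k => (if r.2.2 then Complex.reCLM else Complex.imCLM)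
            (noise η p g B (k, r.1.1) r.1.2)) ^ 2 := by
  rw [hv.frobSq_proj_mul, Fintype.sum_prod_type, Fintype.sum_prod_type]
  refine Finset.sum_congr rfl fun i _ => Finset.sum_congr rfl fun j _ => ?_
  rw [Fintype.sum_prod_type, Finset.sum_subtype (p := fun q : Fin T => T ≤ q.val + τ) _ (by simp)]
  exact Finset.sum_congr rfl fun q _ => by rw [Fintype.sum_bool]; rfl

theorem withProbAtLeast_frobSq_proj_mul_noise_le [IsProbabilityMeasure P]
    (hA : IsOutliersModel P η p g A) (hη : η ∈ Set.Icc (0 : ℝ) 1)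
    (hp : ∀ k, p k ∈ Set.Icc (0 : ℝ) 1) (hg : ∀ k i, ‖g k i‖ = 1) {Q : ℝ≥0} (hηQ : η ≤ Q)
    (hnη : bernoulliNorm η ≤ Q) (hnp : ∀ k, bernoulliNorm (p k) ≤ Q)
    {v : Fin T → Fin T → ℝ} (hv : IsPathEigenbasis v) (τ : ℕ) {δ : ℝ} (hδ : 0 < δ)
    (hδ1 : 1 ≤ Real.log (1 / δ)) :
    WithProbAtLeast P (1 - δ) fun ω =>
      frobSq (proj n v τ * noise η p g (A ω))
        ≤ 414720 * (n : ℝ) ^ 2 * τ * (Q ^ 2 * Real.log (1 / δ)) := by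
  have hmeas : ∀ (l : ℂ →L[ℝ] ℝ) (w : Fin T → ℝ) (i j : Fin n),
      Measurable fun ω => w ⬝ᵥ fun k => l (noise η p g (A ω) (k, i) j) := fun l w i j => by
    simp only [noise_apply]
    exact Finset.measurable_fun_sum _ fun k _ =>
      (l.measurable.comp ((hA.measurable k i j).sub_const _)).const_mul _
  obtain ⟨E, hE, hPE, hgood⟩ := withProbAtLeast_sum_sq_le
    (κ := (Fin n × Fin n) × {l : Fin T // T ≤ l.val + τ} × Bool)
    (fun r => hmeas (if r.2.2 then Complex.reCLM else Complex.imCLM) (v r.2.1.1) r.1.1 r.1.2)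
    (fun r => hA.hasSubgaussianMoments_dotProduct_noise hη hp hg hηQ hnη hnp
      (by split_ifs <;> simp) (by simp [hv.orthonormal]) r.1.1 r.1.2) hδ hδ1
  refine ⟨E, hE, hPE, fun ω hω => ?_⟩
  change frobSq _ ≤ _
  rw [frobSq_proj_mul_noise_eq_sum hv]
  refine (hgood ω hω).trans ?_
  simp only [Fintype.card_prod, Fintype.card_fin, Fintype.card_bool]
  push_cast
  calc _ = 414720 * (n : ℝ) ^ 2 * (Fintype.card {l : Fin T // T ≤ l.val + τ} : ℝ)
        * (Q ^ 2 * Real.log (1 / δ)) := by ring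
    _ ≤ _ := by
        gcongr
        exact_mod_cast card_lowFreq_le T τ

end IsOutliersModel

end Noise

/-! ### Bounds for the parameters -/

section Parameters

variable {T : ℕ} {η : ℝ} {p : Fin T → ℝ}

theorem pMin_le (k : Fin T) : pMin p ≤ p k := ciInf_le (Set.finite_range _).bddBelow k

theorem le_pMin [NeZero T] {c : ℝ} (h : ∀ k, c ≤ p k) : c ≤ pMin p := le_ciInf h

theorem pMin_pos [NeZero T] (hp : ∀ k, 0 < p k) : 0 < pMin p := by
  obtain ⟨k, hk⟩ := exists_eq_ciInf_of_finite (f := p)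
  rw [pMin, ← hk]
  exact hp k

theorem pMax_nonneg (hp : ∀ k, p k ∈ Set.Icc (0 : ℝ) 1) : 0 ≤ pMax p :=
  Real.iSup_nonneg fun k => (hp k).1

theorem varMax_nonneg (hp : ∀ k, p k ∈ Set.Icc (0 : ℝ) 1) : 0 ≤ varMax p :=
  Real.iSup_nonneg fun k => mul_nonneg (hp k).1 (sub_nonneg.mpr (hp k).2)

theorem fNoise_nonneg (hη : η ∈ Set.Icc (0 : ℝ) 1) (hp : ∀ k, p k ∈ Set.Icc (0 : ℝ) 1) :
    0 ≤ fNoise η p := by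
  have := hη.1
  have := sub_nonneg.mpr hη.2
  have := pMax_nonneg hp
  have := varMax_nonneg hp
  unfold fNoise
  positivity

theorem fNoise_le_three [NeZero T] (hη : η ∈ Set.Icc (0 : ℝ) 1)
    (hp : ∀ k, p k ∈ Set.Icc (0 : ℝ) 1) : fNoise η p ≤ 3 := by
  have hη0 : 0 ≤ 1 - η := sub_nonneg.mpr hη.2
  have hη1 : 1 - η ≤ 1 := sub_le_self 1 hη.1
  have hmax : pMax p ≤ 1 := ciSup_le fun k => (hp k).2
  have hvar0 : 0 ≤ varMax p := varMax_nonneg hp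
  have hvar1 : varMax p ≤ 1 := ciSup_le fun k =>
    mul_le_one₀ (hp k).2 (sub_nonneg.mpr (hp k).2) (sub_le_self 1 (hp k).1)
  have := mul_le_one₀ hmax hη.1 hη.2
  have := mul_le_one₀ (pow_le_one₀ hη0 hη1 (n := 2)) hvar0 hvar1
  have := mul_le_one₀ (mul_le_one₀ hmax hvar0 hvar1) hη0 hη1
  unfold fNoise
  linarith

theorem iSup_bernoulliNorm_nonneg : 0 ≤ ⨆ k, bernoulliNorm (p k) :=
  Real.iSup_nonneg fun _ => bernoulliNorm_nonneg _

theorem le_qNoise : η ≤ qNoise η p := by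
  rw [qNoise, add_assoc]
  exact le_add_of_nonneg_right (add_nonneg (bernoulliNorm_nonneg _) iSup_bernoulliNorm_nonneg)

theorem bernoulliNorm_le_qNoise (hη : 0 ≤ η) : bernoulliNorm η ≤ qNoise η p :=
  (le_add_of_nonneg_left hη).trans (le_add_of_nonneg_right iSup_bernoulliNorm_nonneg)

theorem bernoulliNorm_apply_le_qNoise (hη : 0 ≤ η) (k : Fin T) :
    bernoulliNorm (p k) ≤ qNoise η p :=
  (le_ciSup (f := fun k => bernoulliNorm (p k)) (Set.finite_range _).bddAbove k).trans
    (le_add_of_nonneg_left (add_nonneg hη (bernoulliNorm_nonneg _)))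

theorem qNoise_le_three [NeZero T] (hη : η ∈ Set.Icc (0 : ℝ) 1)
    (hp : ∀ k, p k ∈ Set.Icc (0 : ℝ) 1) : qNoise η p ≤ 3 := by
  have hsup : ⨆ k, bernoulliNorm (p k) ≤ 1 := ciSup_le fun k => bernoulliNorm_le_one (hp k)
  have := bernoulliNorm_le_one hη
  unfold qNoise
  linarith [hη.2]

theorem dBar_le [NeZero T] {c : ℝ} (h : ∀ k, (1 - η) * p k ≤ c) : dBar η p ≤ c := by
  rw [dBar, div_le_iff₀ (Nat.cast_pos.mpr (NeZero.pos T))]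
  exact (Finset.sum_le_sum fun k _ => h k).trans_eq (by simp [mul_comm])

theorem le_dBar [NeZero T] {c : ℝ} (h : ∀ k, c ≤ (1 - η) * p k) : c ≤ dBar η p := by
  rw [dBar, le_div_iff₀ (Nat.cast_pos.mpr (NeZero.pos T))]
  exact Eq.trans_le (by simp [mul_comm]) (Finset.sum_le_sum fun k _ => h k)

theorem one_le_log_one_div {δ : ℝ} (h0 : 0 < δ) (h1 : δ < Real.exp (-1)) :
    1 ≤ Real.log (1 / δ) := by
  rw [Real.le_log_iff_exp_le (by positivity), le_one_div (Real.exp_pos _) h0, one_div,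
    ← Real.exp_neg]
  exact h1.le

end Parameters

/-! ### The cut-off -/

section CutOff

variable {n T : ℕ} {η : ℝ} {p : Fin T → ℝ} {S μ δ : ℝ}

theorem one_le_tauStar [NeZero T] : 1 ≤ tauStar n η p μ S δ := by
  have hT : 1 ≤ T := NeZero.one_le
  unfold tauStar
  split_ifs
  · exact hT
  · exact le_min (by omega) hT

theorem tauStar_le : tauStar n η p μ S δ ≤ T := by
  unfold tauStar
  split_ifs
  · exact le_rfl
  · exact min_le_right _ _

theorem fTilde_mul_tauStar_le (hf : 0 ≤ fTilde η p δ) (hρ : 0 ≤ ratio n η p μ S δ) :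
    fTilde η p δ * (tauStar n η p μ S δ : ℝ)
      ≤ fTilde η p δ * min (1 + ratio n η p μ S δ ^ (1 / 3 : ℝ)) T := by
  by_cases h0 : fTilde η p δ = 0
  · simp [h0]
  · refine mul_le_mul_of_nonneg_left ?_ hf
    rw [tauStar, if_neg h0]
    push_cast
    gcongr
    exact Nat.floor_le (by positivity)

theorem one_add_ratio_rpow_le_two_mul_tauStar_sq (hρ : 0 ≤ ratio n η p μ S δ)
    (hlt : tauStar n η p μ S δ < T) :
    1 + ratio n η p μ S δ ^ (2 / 3 : ℝ) ≤ 2 * (tauStar n η p μ S δ : ℝ) ^ 2 := by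
  have hτ : tauStar n η p μ S δ = 1 + ⌊ratio n η p μ S δ ^ (1 / 3 : ℝ)⌋₊ := by
    unfold tauStar at hlt ⊢
    split_ifs at hlt ⊢ <;> omega
  have hsq : ratio n η p μ S δ ^ (2 / 3 : ℝ) = (ratio n η p μ S δ ^ (1 / 3 : ℝ)) ^ 2 := by
    rw [← Real.rpow_natCast, ← Real.rpow_mul hρ]
    norm_num
  have hone : (1 : ℝ) ≤ tauStar n η p μ S δ := by
    rw [hτ]
    push_cast
    exact le_add_of_nonneg_right (Nat.cast_nonneg _)
  have hroot : ratio n η p μ S δ ^ (1 / 3 : ℝ) ≤ tauStar n η p μ S δ := by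
    rw [hτ, add_comm]
    push_cast
    exact (Nat.lt_floor_add_one _).le
  rw [hsq, two_mul]
  gcongr
  exact one_le_pow₀ hone

end CutOff

namespace IsSetting

variable {n T : ℕ} [NeZero n] {Ω : Type*} [MeasurableSpace Ω] {P : Measure Ω}
  {v : Fin T → Fin T → ℝ} {η : ℝ} {p : Fin T → ℝ} {g : Fin T → Fin n → ℂ} {S μ : ℝ}
  {A : Ω → Fin T → Matrix (Fin n) (Fin n) ℂ} {δ : ℝ}

theorem eta_mem (h : IsSetting P v η p g S μ A) : η ∈ Set.Icc (0 : ℝ) 1 :=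
  ⟨h.eta_nonneg, h.eta_lt_one.le⟩

theorem p_mem (h : IsSetting P v η p g S μ A) (k : Fin T) : p k ∈ Set.Icc (0 : ℝ) 1 :=
  ⟨(h.p_pos k).le, h.p_le_one k⟩

theorem mu_nonneg (h : IsSetting P v η p g S μ A) : 0 ≤ μ := zero_le_one.trans h.mu_ge_one

theorem qNoise_sq_mul_log_le_fTilde (h : IsSetting P v η p g S μ A) (δ : ℝ) :
    qNoise η p ^ 2 * Real.log (1 / δ) ≤ fTilde η p δ :=
  le_add_of_nonneg_left (fNoise_nonneg h.eta_mem h.p_mem)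

theorem fTilde_nonneg (h : IsSetting P v η p g S μ A) (hδ : 1 ≤ Real.log (1 / δ)) :
    0 ≤ fTilde η p δ :=
  le_trans (by positivity) (h.qNoise_sq_mul_log_le_fTilde δ)

theorem le_fTilde (h : IsSetting P v η p g S μ A) (hδ : 1 ≤ Real.log (1 / δ)) :
    η ^ 2 * Real.log (1 / δ) ≤ fTilde η p δ := by
  refine le_trans ?_ (h.qNoise_sq_mul_log_le_fTilde δ)
  have := h.eta_nonneg
  gcongr
  exact le_qNoise

theorem ratio_nonneg (h : IsSetting P v η p g S μ A) (hδ : 1 ≤ Real.log (1 / δ)) :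
    0 ≤ ratio n η p μ S δ := by
  have := h.fTilde_nonneg hδ
  have := h.S_nonneg
  have := h.mu_nonneg
  unfold ratio
  positivity

variable [NeZero T]

theorem dBar_pos (h : IsSetting P v η p g S μ A) : 0 < dBar η p := by
  have hη : 0 < 1 - η := sub_pos.mpr h.eta_lt_one
  exact (mul_pos hη (pMin_pos h.p_pos)).trans_le (le_dBar fun k => by gcongr; exact pMin_le k)

theorem mu_mul_dBar_sq_pos (h : IsSetting P v η p g S μ A) : 0 < μ * dBar η p ^ 2 :=
  mul_pos (zero_lt_one.trans_le h.mu_ge_one) (pow_pos h.dBar_pos 2)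

end IsSetting

/-! ### The general error bound -/

section GeneralBound

variable {n T : ℕ}

theorem WithProbAtLeast.mono {Ω : Type*} [MeasurableSpace Ω] {P : Measure Ω} {r : ℝ}
    {good good' : Ω → Prop} (h : WithProbAtLeast P r good) (himp : ∀ ω, good ω → good' ω) :
    WithProbAtLeast P r good' :=
  let ⟨E, hE, hPE, hgood⟩ := h
  ⟨E, hE, hPE, fun ω hω => himp ω (hgood ω hω)⟩

theorem frobSq_gHat_sub_le (v : Fin T → Fin T → ℝ) (τ : ℕ) (η : ℝ) (p : Fin T → ℝ)
    (g : Fin T → Fin n → ℂ) (A : Fin T → Matrix (Fin n) (Fin n) ℂ) :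
    frobSq (gHat v τ A - dMat n η p * gBar g)
      ≤ 2 * (frobSq (proj n v τ * noise η p g A)
        + frobSq ((1 - proj n v τ) * (dMat n η p * gBar g))) := by
  have hsplit : gHat v τ A - dMat n η p * gBar g
      = proj n v τ * noise η p g A + -((1 - proj n v τ) * (dMat n η p * gBar g)) := by
    rw [gHat, noise, Matrix.mul_sub, Matrix.sub_mul, Matrix.one_mul]
    abel
  rw [hsplit, ← frobSq_neg ((1 - proj n v τ) * (dMat n η p * gBar g))]
  exact frobSq_add_le _ _

namespace IsSetting

variable [NeZero n] {Ω : Type*} [MeasurableSpace Ω] {P : Measure Ω}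
  {v : Fin T → Fin T → ℝ} {η : ℝ} {p : Fin T → ℝ} {g : Fin T → Fin n → ℂ} {S μ : ℝ}
  {A : Ω → Fin T → Matrix (Fin n) (Fin n) ℂ} {δ : ℝ}

theorem withProbAtLeast_frobSq_noise_le (h : IsSetting P v η p g S μ A) (hδ0 : 0 < δ)
    (hδ : 1 ≤ Real.log (1 / δ)) :
    WithProbAtLeast P (1 - δ) fun ω =>
      frobSq (proj n v (tauStar n η p μ S δ) * noise η p g (A ω))
        ≤ 414720 * (fTilde η p δ * (n : ℝ) ^ 2
          * min (1 + ratio n η p μ S δ ^ (1 / 3 : ℝ)) T) := by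
  have := h.prob
  have hQ : 0 ≤ qNoise η p := h.eta_nonneg.trans le_qNoise
  refine (h.model.withProbAtLeast_frobSq_proj_mul_noise_le (Q := ⟨qNoise η p, hQ⟩) h.eta_mem
    h.p_mem h.truth.unit le_qNoise (bernoulliNorm_le_qNoise h.eta_nonneg)
    (bernoulliNorm_apply_le_qNoise h.eta_nonneg) h.basis (tauStar n η p μ S δ) hδ0 hδ).mono
    fun ω hω => hω.trans ?_
  calc 414720 * (n : ℝ) ^ 2 * tauStar n η p μ S δ * (qNoise η p ^ 2 * Real.log (1 / δ))
      ≤ 414720 * (n : ℝ) ^ 2 * tauStar n η p μ S δ * fTilde η p δ := by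
        gcongr
        exact h.qNoise_sq_mul_log_le_fTilde δ
    _ = 414720 * (n : ℝ) ^ 2 * (fTilde η p δ * tauStar n η p μ S δ) := by ring
    _ ≤ 414720 * (n : ℝ) ^ 2
          * (fTilde η p δ * min (1 + ratio n η p μ S δ ^ (1 / 3 : ℝ)) T) :=
        mul_le_mul_of_nonneg_left (fTilde_mul_tauStar_le (h.fTilde_nonneg hδ)
          (h.ratio_nonneg hδ)) (by positivity)
    _ = _ := by ring

variable [NeZero T]

theorem frobSq_bias_le_of_lt (h : IsSetting P v η p g S μ A) (hδ : 1 ≤ Real.log (1 / δ))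
    (hlt : tauStar n η p μ S δ < T) :
    frobSq ((1 - proj n v (tauStar n η p μ S δ)) * (dMat n η p * gBar g))
      ≤ 32 * (μ * dBar η p ^ 2 * n * (T : ℝ) ^ 2 * S
          / (1 + ratio n η p μ S δ ^ (2 / 3 : ℝ))) := by
  have hρ := h.ratio_nonneg hδ
  have hμ := h.mu_nonneg
  have hcut := one_add_ratio_rpow_le_two_mul_tauStar_sq hρ hlt
  set τ := tauStar n η p μ S δ
  set bias := frobSq ((1 - proj n v τ) * gBar g)
  have hbias : (τ : ℝ) ^ 2 * bias ≤ 16 * (T : ℝ) ^ 2 * n * S :=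
    (h.basis.sq_mul_frobSq_one_sub_proj_mul_gBar_le one_le_tauStar h.truth.unit).trans
      (by gcongr; exact h.truth.smooth)
  calc frobSq ((1 - proj n v τ) * (dMat n η p * gBar g))
      ≤ μ * dBar η p ^ 2 * bias := h.d_smooth τ one_le_tauStar hlt.le
    _ ≤ μ * dBar η p ^ 2
          * (32 * (T : ℝ) ^ 2 * n * S / (1 + ratio n η p μ S δ ^ (2 / 3 : ℝ))) := by
        gcongr
        rw [le_div_iff₀ (by positivity)]
        linarith [mul_le_mul_of_nonneg_left hcut (frobSq_nonneg ((1 - proj n v τ) * gBar g))]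
    _ = _ := by ring

theorem frobSq_bias_le (h : IsSetting P v η p g S μ A) (hδ : 1 ≤ Real.log (1 / δ)) :
    frobSq ((1 - proj n v (tauStar n η p μ S δ)) * (dMat n η p * gBar g))
      ≤ 32 * (max (μ * dBar η p ^ 2 * n * (T : ℝ) ^ 2 * S
          / (1 + ratio n η p μ S δ ^ (2 / 3 : ℝ))) (μ * dBar η p ^ 2 * n * S)
        * (if tauStar n η p μ S δ < T then 1 else 0)) := by
  split_ifs with hlt
  · rw [mul_one]
    exact (h.frobSq_bias_le_of_lt hδ hlt).trans (by gcongr; exact le_max_left _ _)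
  · have hτ : tauStar n η p μ S δ = T := le_antisymm tauStar_le (not_lt.mp hlt)
    rw [hτ, h.basis.one_sub_proj_self, Matrix.zero_mul]
    simp [frobSq]

theorem withProbAtLeast_distSq_le_generalBound (h : IsSetting P v η p g S μ A) (hδ0 : 0 < δ)
    (hδ : 1 ≤ Real.log (1 / δ)) :
    WithProbAtLeast P (1 - δ) fun ω => ∀ gh : Fin T → Fin n → ℂ,
      IsOutput v (tauStar n η p μ S δ) (A ω) gh →
        distSq gh g ≤ generalBound 13271040 n η p μ S δ := by
  refine (h.withProbAtLeast_frobSq_noise_le hδ0 hδ).mono fun ω hnoise gh hgh => ?_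
  have hη : 0 < 1 - η := sub_pos.mpr h.eta_lt_one
  have hd : 0 < (1 - η) * pMin p := mul_pos hη (pMin_pos h.p_pos)
  have hsync := sq_mul_distSq_le_frobSq h.truth.unit h.truth.anchor hgh hd.le
    fun k => mul_le_mul_of_nonneg_left (pMin_le k) hη.le
  have hsplit := frobSq_gHat_sub_le v (tauStar n η p μ S δ) η p g (A ω)
  have hbias := h.frobSq_bias_le hδ
  have hbias_nonneg := (frobSq_nonneg _).trans hbias
  rw [generalBound, ← mul_pow, div_mul_eq_mul_div, le_div_iff₀' (pow_pos hd 2)]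
  linarith

end IsSetting

end GeneralBound

/-! ### Long time horizons -/

/-- The bias `K y ^ 3 / (1 + y ^ 2)` and the noise `K (1 + y)` at the cut-off `y`. -/
theorem max_add_le_three_mul {K y T : ℝ} (hK : 0 ≤ K) (hy : 1 ≤ y) (hyT : y ≤ T) :
    max (K * y ^ 3 / (1 + y ^ 2)) (K * y ^ 3 / T ^ 2) + K * (1 + y) ≤ 3 * (K * y) := by
  have hy0 : 0 ≤ y := zero_le_one.trans hy
  have hKy : 0 ≤ K * y := mul_nonneg hK hy0
  have hcut : K * y ^ 3 / (1 + y ^ 2) ≤ K * y := by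
    rw [div_le_iff₀ (by positivity)]
    linarith
  have hhorizon : K * y ^ 3 / T ^ 2 ≤ K * y := by
    rw [div_le_iff₀ (pow_pos (zero_lt_one.trans_le (hy.trans hyT)) 2)]
    calc K * y ^ 3 = K * y * y ^ 2 := by ring
      _ ≤ K * y * T ^ 2 := by gcongr
  linarith [max_le hcut hhorizon, mul_le_mul_of_nonneg_left hy hK]

theorem rpow_two_thirds_mul_rpow_one_third {x : ℝ} (hx : 0 < x) :
    x ^ (2 / 3 : ℝ) * x ^ (1 / 3 : ℝ) = x := by
  rw [← Real.rpow_add hx]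
  norm_num

theorem rpow_five_thirds_mul_rpow_one_third {x : ℝ} (hx : 0 < x) :
    x ^ (5 / 3 : ℝ) * x ^ (1 / 3 : ℝ) = x ^ 2 := by
  rw [← Real.rpow_add hx, ← Real.rpow_natCast]
  norm_num

theorem sq_rpow_one_third {x : ℝ} (hx : 0 ≤ x) : (x ^ 2) ^ (1 / 3 : ℝ) = x ^ (2 / 3 : ℝ) := by
  rw [← Real.rpow_natCast, ← Real.rpow_mul hx]
  norm_num

section LongHorizon

variable {n T : ℕ} {η : ℝ} {p : Fin T → ℝ} {S μ δ : ℝ}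

theorem ratio_le_pow_three_of_largeT (hT : LargeT 1 n η p μ S δ) :
    ratio n η p μ S δ ≤ (T : ℝ) ^ 3 := by
  rw [LargeT, one_mul, max_le_iff] at hT
  calc ratio n η p μ S δ = μ * dBar η p ^ 2 * S / (n * fTilde η p δ) * (T : ℝ) ^ 2 := by
        unfold ratio
        ring
    _ ≤ T * (T : ℝ) ^ 2 := by
        gcongr
        exact hT.2
    _ = (T : ℝ) ^ 3 := by ring

variable [NeZero n]

theorem fTilde_mul_ratio (hf : 0 < fTilde η p δ) :
    fTilde η p δ * (n : ℝ) ^ 2 * ratio n η p μ S δ = μ * dBar η p ^ 2 * n * (T : ℝ) ^ 2 * S := by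
  have hn : (0 : ℝ) < n := Nat.cast_pos.mpr (NeZero.pos n)
  unfold ratio
  field_simp

theorem one_le_ratio_of_largeT (hf : 0 < fTilde η p δ) (hMS : 0 < μ * dBar η p ^ 2 * S)
    (hT : LargeT 1 n η p μ S δ) : 1 ≤ ratio n η p μ S δ := by
  have hn : (0 : ℝ) < n := Nat.cast_pos.mpr (NeZero.pos n)
  rw [LargeT, one_mul, max_le_iff, ← Real.sqrt_eq_rpow, Real.sqrt_le_iff,
    div_le_iff₀ hMS] at hT
  rw [ratio, one_le_div (by positivity)]
  linarith [hT.1.2]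

variable [NeZero T]

theorem fTilde_mul_ratio_rpow (hf : 0 < fTilde η p δ) (hM : 0 ≤ μ * dBar η p ^ 2) (hS : 0 ≤ S) :
    fTilde η p δ * (n : ℝ) ^ 2 * ratio n η p μ S δ ^ (1 / 3 : ℝ)
      = fTilde η p δ ^ (2 / 3 : ℝ) * (μ * dBar η p ^ 2) ^ (1 / 3 : ℝ) * (n : ℝ) ^ (5 / 3 : ℝ)
        * (T : ℝ) ^ (2 / 3 : ℝ) * S ^ (1 / 3 : ℝ) := by
  have hn : (0 : ℝ) < n := Nat.cast_pos.mpr (NeZero.pos n)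
  have hT : (0 : ℝ) < T := Nat.cast_pos.mpr (NeZero.pos T)
  rw [ratio, Real.div_rpow (by positivity) (by positivity), Real.mul_rpow (by positivity) hS,
    Real.mul_rpow hM (by positivity), Real.mul_rpow hn.le hf.le, sq_rpow_one_third hT.le,
    ← rpow_five_thirds_mul_rpow_one_third hn]
  nth_rewrite 1 [← rpow_two_thirds_mul_rpow_one_third hf]
  field_simp

theorem max_bias_add_noise_le (hf : 0 < fTilde η p δ) (hM : 0 < μ * dBar η p ^ 2) (hS : 0 < S)
    (hT : LargeT 1 n η p μ S δ) :
    max (μ * dBar η p ^ 2 * n * (T : ℝ) ^ 2 * S / (1 + ratio n η p μ S δ ^ (2 / 3 : ℝ)))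
        (μ * dBar η p ^ 2 * n * S)
        + fTilde η p δ * (n : ℝ) ^ 2 * (1 + ratio n η p μ S δ ^ (1 / 3 : ℝ))
      ≤ 3 * (fTilde η p δ ^ (2 / 3 : ℝ) * (μ * dBar η p ^ 2) ^ (1 / 3 : ℝ)
        * (n : ℝ) ^ (5 / 3 : ℝ) * (T : ℝ) ^ (2 / 3 : ℝ) * S ^ (1 / 3 : ℝ)) := by
  have hT0 : (0 : ℝ) < T := Nat.cast_pos.mpr (NeZero.pos T)
  have hρ1 := one_le_ratio_of_largeT hf (mul_pos hM hS) hT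
  have hρT := ratio_le_pow_three_of_largeT hT
  have hbias := fTilde_mul_ratio (n := n) (μ := μ) (S := S) hf
  rw [← fTilde_mul_ratio_rpow hf hM.le hS.le]
  set ρ := ratio n η p μ S δ
  set y := ρ ^ (1 / 3 : ℝ) with hy
  have hρ0 : 0 ≤ ρ := zero_le_one.trans hρ1
  have hy3 : y ^ 3 = ρ := by
    rw [hy, ← Real.rpow_natCast, ← Real.rpow_mul hρ0]
    norm_num
  have hy2 : ρ ^ (2 / 3 : ℝ) = y ^ 2 := by
    rw [hy, ← Real.rpow_natCast, ← Real.rpow_mul hρ0]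
    norm_num
  have hy1 : 1 ≤ y := Real.one_le_rpow hρ1 (by norm_num)
  have hyT : y ≤ T := le_of_pow_le_pow_left₀ three_ne_zero hT0.le (hy3.trans_le hρT)
  have hend : μ * dBar η p ^ 2 * n * S = fTilde η p δ * (n : ℝ) ^ 2 * y ^ 3 / (T : ℝ) ^ 2 := by
    rw [hy3, hbias]
    field_simp
  rw [hend, ← hbias, hy2, ← hy3]
  exact max_add_le_three_mul (by positivity) hy1 hyT

theorem IsSetting.generalBound_le_simpleBound {Ω : Type*} [MeasurableSpace Ω] {P : Measure Ω}
    {v : Fin T → Fin T → ℝ} {g : Fin T → Fin n → ℂ} {A : Ω → Fin T → Matrix (Fin n) (Fin n) ℂ}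
    (h : IsSetting P v η p g S μ A) (hδ : 1 ≤ Real.log (1 / δ)) {C : ℝ} (hC : 0 ≤ C) (hS : 0 < S)
    (hT : LargeT 1 n η p μ S δ) :
    generalBound C n η p μ S δ ≤ simpleBound (3 * C) n η p μ S δ := by
  have hM := h.mu_mul_dBar_sq_pos
  rcases (h.fTilde_nonneg hδ).eq_or_lt with hf | hf
  · have hτ : tauStar n η p μ S δ = T := by rw [tauStar, if_pos hf.symm]
    simp [generalBound, simpleBound, hτ, ← hf]
  calc generalBound C n η p μ S δ
      ≤ C / ((1 - η) ^ 2 * pMin p ^ 2) *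
        (max (μ * dBar η p ^ 2 * n * (T : ℝ) ^ 2 * S / (1 + ratio n η p μ S δ ^ (2 / 3 : ℝ)))
          (μ * dBar η p ^ 2 * n * S)
          + fTilde η p δ * (n : ℝ) ^ 2 * (1 + ratio n η p μ S δ ^ (1 / 3 : ℝ))) := by
        unfold generalBound
        gcongr
        · refine mul_le_of_le_one_right (le_max_of_le_right (by positivity)) ?_
          split_ifs <;> norm_num
        · exact min_le_left _ _
    _ ≤ C / ((1 - η) ^ 2 * pMin p ^ 2) * (3 * (fTilde η p δ ^ (2 / 3 : ℝ)
          * (μ * dBar η p ^ 2) ^ (1 / 3 : ℝ) * (n : ℝ) ^ (5 / 3 : ℝ) * (T : ℝ) ^ (2 / 3 : ℝ)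
          * S ^ (1 / 3 : ℝ))) := by
        gcongr
        exact max_bias_add_noise_le hf hM hS hT
    _ = simpleBound (3 * C) n η p μ S δ := by
        unfold simpleBound
        ring

end LongHorizon

/-! ### The sparse regime -/

namespace IsSetting

variable {n T : ℕ} [NeZero n] [NeZero T] {Ω : Type*} [MeasurableSpace Ω] {P : Measure Ω}
  {v : Fin T → Fin T → ℝ} {η : ℝ} {p : Fin T → ℝ} {g : Fin T → Fin n → ℂ} {S μ : ℝ}
  {A : Ω → Fin T → Matrix (Fin n) (Fin n) ℂ} {δ a b m : ℝ}

theorem fTilde_le (h : IsSetting P v η p g S μ A) (hδ : 1 ≤ Real.log (1 / δ)) :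
    fTilde η p δ ≤ 12 * Real.log (1 / δ) := by
  have hQ : qNoise η p ^ 2 ≤ 3 ^ 2 :=
    pow_le_pow_left₀ (h.eta_nonneg.trans le_qNoise) (qNoise_le_three h.eta_mem h.p_mem) 2
  calc fTilde η p δ ≤ 3 * 1 + 3 ^ 2 * Real.log (1 / δ) := by
        rw [mul_one]
        exact add_le_add (fNoise_le_three h.eta_mem h.p_mem) (by gcongr)
    _ ≤ 12 * Real.log (1 / δ) := by linarith

theorem mu_mul_dBar_sq_mem (h : IsSetting P v η p g S μ A) (ha : 0 < a)
    (hp : ∀ k, p k ∈ Set.Icc (a / n) (b / n)) (hμ : μ ≤ m) :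
    μ * dBar η p ^ 2 ∈ Set.Icc ((1 - η) ^ 2 * a ^ 2 / (n : ℝ) ^ 2)
      (m * (1 - η) ^ 2 * b ^ 2 / (n : ℝ) ^ 2) := by
  have hη : 0 < 1 - η := sub_pos.mpr h.eta_lt_one
  have hd := h.dBar_pos
  have hlow : (1 - η) * (a / n) ≤ dBar η p :=
    le_dBar fun k => mul_le_mul_of_nonneg_left (hp k).1 hη.le
  have hupp : dBar η p ≤ (1 - η) * (b / n) :=
    dBar_le fun k => mul_le_mul_of_nonneg_left (hp k).2 hη.le
  constructor
  · calc (1 - η) ^ 2 * a ^ 2 / (n : ℝ) ^ 2 = 1 * ((1 - η) * (a / n)) ^ 2 := by ring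
      _ ≤ μ * dBar η p ^ 2 := by
        have := h.mu_ge_one
        gcongr
  · calc μ * dBar η p ^ 2 ≤ m * ((1 - η) * (b / n)) ^ 2 := by
          have := h.mu_nonneg.trans hμ
          gcongr
      _ = _ := by ring

theorem largeT_of_sparse (h : IsSetting P v η p g S μ A) (hη0 : 0 < η) (ha : 0 < a)
    (hp : ∀ k, p k ∈ Set.Icc (a / n) (b / n)) (hμ : μ ≤ m) (hS : 0 < S)
    (hδ : 1 ≤ Real.log (1 / δ))
    (hT : max ((12 / ((1 - η) ^ 2 * a ^ 2)) ^ (1 / 2 : ℝ)) (m * (1 - η) ^ 2 * b ^ 2 / η ^ 2)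
      * max (((n : ℝ) ^ 3 * Real.log (1 / δ) / S) ^ (1 / 2 : ℝ))
        (S / ((n : ℝ) ^ 3 * Real.log (1 / δ))) ≤ T) :
    LargeT 1 n η p μ S δ := by
  have hn : (0 : ℝ) < n := Nat.cast_pos.mpr (NeZero.pos n)
  have hη : 0 < 1 - η := sub_pos.mpr h.eta_lt_one
  obtain ⟨hM_low, hM_upp⟩ := h.mu_mul_dBar_sq_mem ha hp hμ
  have hM := h.mu_mul_dBar_sq_pos
  have hf := h.fTilde_nonneg hδ
  have hf_low := h.le_fTilde hδ
  have hf_upp := h.fTilde_le hδ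
  have hm : 0 ≤ m := h.mu_nonneg.trans hμ
  rw [LargeT, one_mul]
  refine (max_le ?_ ?_).trans hT
  · calc (n * fTilde η p δ / (μ * dBar η p ^ 2 * S)) ^ (1 / 2 : ℝ)
        ≤ (n * (12 * Real.log (1 / δ))
            / ((1 - η) ^ 2 * a ^ 2 / (n : ℝ) ^ 2 * S)) ^ (1 / 2 : ℝ) := by gcongr
      _ = (12 / ((1 - η) ^ 2 * a ^ 2)
            * ((n : ℝ) ^ 3 * Real.log (1 / δ) / S)) ^ (1 / 2 : ℝ) := by
          congr 1
          field_simp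
      _ = (12 / ((1 - η) ^ 2 * a ^ 2)) ^ (1 / 2 : ℝ)
            * ((n : ℝ) ^ 3 * Real.log (1 / δ) / S) ^ (1 / 2 : ℝ) :=
          Real.mul_rpow (by positivity) (by positivity)
      _ ≤ _ := by
          gcongr
          · exact le_max_left _ _
          · exact le_max_left _ _
  · calc μ * dBar η p ^ 2 * S / (n * fTilde η p δ)
        ≤ m * (1 - η) ^ 2 * b ^ 2 / (n : ℝ) ^ 2 * S / (n * (η ^ 2 * Real.log (1 / δ))) := by
          gcongr
      _ = m * (1 - η) ^ 2 * b ^ 2 / η ^ 2 * (S / ((n : ℝ) ^ 3 * Real.log (1 / δ))) := by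
          field_simp
      _ ≤ _ := by
          gcongr
          · exact le_max_right _ _
          · exact le_max_right _ _

theorem simpleBound_le_of_sparse (h : IsSetting P v η p g S μ A) (ha : 0 < a)
    (hp : ∀ k, p k ∈ Set.Icc (a / n) (b / n)) (hμ : μ ≤ m) (hδ : 1 ≤ Real.log (1 / δ)) {C : ℝ}
    (hC : 0 ≤ C) :
    simpleBound C n η p μ S δ ≤
      C * 12 ^ (2 / 3 : ℝ) / ((1 - η) ^ 2 * a ^ 2) * (m * (1 - η) ^ 2 * b ^ 2) ^ (1 / 3 : ℝ)
        * (n : ℝ) ^ 3 * (T : ℝ) ^ (2 / 3 : ℝ) * S ^ (1 / 3 : ℝ)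
        * Real.log (1 / δ) ^ (2 / 3 : ℝ) := by
  have hn : (0 : ℝ) < n := Nat.cast_pos.mpr (NeZero.pos n)
  have hη : 0 < 1 - η := sub_pos.mpr h.eta_lt_one
  have hM := h.mu_mul_dBar_sq_pos
  have hM_upp := (h.mu_mul_dBar_sq_mem ha hp hμ).2
  have hf := h.fTilde_nonneg hδ
  have hf_upp := h.fTilde_le hδ
  have hpm : a / n ≤ pMin p := le_pMin fun k => (hp k).1
  have hS := h.S_nonneg
  have hm : 0 ≤ m := h.mu_nonneg.trans hμ
  have hn53 : (n : ℝ) ^ (5 / 3 : ℝ) = n * ((n : ℝ) ^ 2) ^ (1 / 3 : ℝ) := by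
    rw [sq_rpow_one_third hn.le, ← Real.rpow_one_add' hn.le (by norm_num)]
    norm_num
  calc simpleBound C n η p μ S δ
      ≤ C * ((12 * Real.log (1 / δ)) ^ (2 / 3 : ℝ) / ((1 - η) ^ 2 * (a / n) ^ 2))
        * (m * (1 - η) ^ 2 * b ^ 2 / (n : ℝ) ^ 2) ^ (1 / 3 : ℝ) * (n : ℝ) ^ (5 / 3 : ℝ)
        * (T : ℝ) ^ (2 / 3 : ℝ) * S ^ (1 / 3 : ℝ) := by
        unfold simpleBound
        gcongr
    _ = _ := by
        rw [Real.mul_rpow (by norm_num) (by positivity), Real.div_rpow (by positivity)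
          (by positivity), hn53]
        field_simp

end IsSetting

end DynSync

theorem mainTheorem5 :
    ∃ C₁ C₂ C₃ C₄ : ℝ, 0 < C₁ ∧ C₁ < 1 ∧ 0 < C₂ ∧ 0 < C₃ ∧ 0 < C₄ ∧
      -- the general bound, and the simplified bound that it implies for large `T`
      (∀ (n T : ℕ) [NeZero n] [NeZero T] (Ω : Type u) [MeasurableSpace Ω] (P : Measure Ω)
          (v : Fin T → Fin T → ℝ) (η : ℝ) (p : Fin T → ℝ) (g : Fin T → Fin n → ℂ) (S μ : ℝ)
          (A : Ω → Fin T → Matrix (Fin n) (Fin n) ℂ),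
          DynSync.IsSetting P v η p g S μ A →
          ∀ δ : ℝ, 0 < δ → δ < C₁ →
            DynSync.WithProbAtLeast P (1 - δ) (fun ω =>
              ∀ gh : Fin T → Fin n → ℂ,
                DynSync.IsOutput v (DynSync.tauStar n η p μ S δ) (A ω) gh →
                  DynSync.distSq gh g ≤ DynSync.generalBound C₂ n η p μ S δ ∧
                  (0 < S → DynSync.LargeT C₃ n η p μ S δ →
                    DynSync.distSq gh g ≤ DynSync.simpleBound C₄ n η p μ S δ)) ∧
            (0 < S → DynSync.LargeT C₃ n η p μ S δ →
              DynSync.generalBound C₂ n η p μ S δ ≤ DynSync.simpleBound C₄ n η p μ S δ)) ∧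
      -- the sparse regime, where all connection probabilities are of order `1 / n`
      (∀ η a b m : ℝ, 0 < η → η < 1 → 0 < a → 0 < b → 1 ≤ m →
        ∃ K₁ K₂ : ℝ, 0 < K₁ ∧ 0 < K₂ ∧
          ∀ (n T : ℕ) [NeZero n] [NeZero T] (Ω : Type u) [MeasurableSpace Ω] (P : Measure Ω)
            (v : Fin T → Fin T → ℝ) (p : Fin T → ℝ) (g : Fin T → Fin n → ℂ) (S μ : ℝ)
            (A : Ω → Fin T → Matrix (Fin n) (Fin n) ℂ),
            DynSync.IsSetting P v η p g S μ A →
            (∀ k, a / n ≤ p k ∧ p k ≤ b / n) → μ ≤ m → 0 < S →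
            ∀ δ : ℝ, 0 < δ → δ < C₁ →
              K₁ * max (((n : ℝ) ^ 3 * Real.log (1 / δ) / S) ^ (1 / 2 : ℝ))
                (S / ((n : ℝ) ^ 3 * Real.log (1 / δ))) ≤ T →
              DynSync.WithProbAtLeast P (1 - δ) (fun ω =>
                ∀ gh : Fin T → Fin n → ℂ,
                  DynSync.IsOutput v (DynSync.tauStar n η p μ S δ) (A ω) gh →
                    DynSync.distSq gh g ≤
                      K₂ * (n : ℝ) ^ 3 * (T : ℝ) ^ (2 / 3 : ℝ) * S ^ (1 / 3 : ℝ) *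
                        Real.log (1 / δ) ^ (2 / 3 : ℝ))) := by
  refine ⟨Real.exp (-1), 13271040, 1, 3 * 13271040, Real.exp_pos _,
    Real.exp_lt_one_iff.mpr (by norm_num), by norm_num, by norm_num, by norm_num,
    fun n T _ _ Ω _ P v η p g S μ A h δ hδ0 hδ1 => ?_, fun η a b m hη0 hη1 ha hb hm => ?_⟩
  · have hδ := DynSync.one_le_log_one_div hδ0 hδ1
    have hsimple := fun hS hT =>
      h.generalBound_le_simpleBound hδ (C := 13271040) (by norm_num) hS hT
    exact ⟨(h.withProbAtLeast_distSq_le_generalBound hδ0 hδ).mono fun ω hω gh hgh =>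
      ⟨hω gh hgh, fun hS hT => (hω gh hgh).trans (hsimple hS hT)⟩, hsimple⟩
  · have : 0 < 1 - η := sub_pos.mpr hη1
    refine ⟨max ((12 / ((1 - η) ^ 2 * a ^ 2)) ^ (1 / 2 : ℝ)) (m * (1 - η) ^ 2 * b ^ 2 / η ^ 2),
      3 * 13271040 * 12 ^ (2 / 3 : ℝ) / ((1 - η) ^ 2 * a ^ 2)
        * (m * (1 - η) ^ 2 * b ^ 2) ^ (1 / 3 : ℝ),
      lt_max_of_lt_left (by positivity), by positivity,
      fun n T _ _ Ω _ P v p g S μ A h hp hμ hS δ hδ0 hδ1 hT => ?_⟩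
    have hδ := DynSync.one_le_log_one_div hδ0 hδ1
    have hlarge := h.largeT_of_sparse hη0 ha hp hμ hS hδ hT
    have hsimple := h.generalBound_le_simpleBound hδ (C := 13271040) (by norm_num) hS hlarge
    exact (h.withProbAtLeast_distSq_le_generalBound hδ0 hδ).mono fun ω hω gh hgh =>
      (hω gh hgh).trans (hsimple.trans (h.simpleBound_le_of_sparse ha hp hμ hδ (by norm_num)))
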